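/- Let $k\ge 3$ and $t\ge 1$ be integers, and let $G$ be a connected finite simple graph on $n$ vertices, where $n\ge 3kt^2+k+18t+4$. For a graph $F$ write $c(F)$ for its number of connected components, and suppose that $G$ is $\frac{t}{t(k-2)+1}$-tough, that is, $|S|\ge \frac{t}{t(k-2)+1}\,c(G-S)$ for every $S\subseteq V(G)$ with $c(G-S)\ge 2$. Let $q(F)$ denote the largest eigenvalue of the signless Laplacian matrix $Q(F)=D(F)+A(F)$, where $D(F)$ is the diagonal matrix of vertex degrees and $A(F)$ is the adjacency matrix of $F$. Let $$H=K_{3t}\vee\bigl(K_{n-3t(k-1)-2}\cup(3t(k-2)+2)K_1\bigr),$$ where $\cup$ is disjoint union, $mK_1$ is the graph with $m$ vertices and no edges, and $\vee$ is the join (the disjoint union together with all edges between the two parts). If $q(G)\ge q(H)$, then $G$ has a spanning $k$-tree, that is, a spanning subgraph which is a tree of maximum degree at most $k$, unless $G\cong H$. -/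

import Mathlib

namespace ToughKTree

/-- The join `G ∨ H` of two disjoint graphs: their disjoint union together with all edges between
a vertex of `G` and a vertex of `H`. -/
def join {V W : Type*} (G : SimpleGraph V) (H : SimpleGraph W) : SimpleGraph (V ⊕ W) :=
  SimpleGraph.sum G H ⊔ completeBipartiteGraph V W

/-- `G - S`: the graph obtained from `G` by deleting the vertices in `S`. -/
def deleteVertices {V : Type*} (G : SimpleGraph V) (S : Finset V) :
    SimpleGraph ((S : Set V)ᶜ : Set V) :=
  G.induce ((S : Set V)ᶜ)

/-- `c(G)`: the number of connected components of `G`. -/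
noncomputable def numComponents {V : Type*} (G : SimpleGraph V) : ℕ :=
  Nat.card G.ConnectedComponent

/-- `G` is `τ`-tough: `|S| ≥ τ · c(G - S)` for every vertex set `S` with `c(G - S) ≥ 2`. -/
def IsTough {V : Type*} (G : SimpleGraph V) (τ : ℝ) : Prop :=
  ∀ S : Finset V, 2 ≤ numComponents (deleteVertices G S) →
    τ * (numComponents (deleteVertices G S) : ℝ) ≤ (S.card : ℝ)

open Classical in
/-- The signless Laplacian matrix `Q(G) = D(G) + A(G)`. -/
noncomputable def signlessLaplacian {V : Type*} [Fintype V] (G : SimpleGraph V) :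
    Matrix V V ℝ :=
  G.degMatrix ℝ + G.adjMatrix ℝ

open Classical in
/-- `q(G)`: the largest eigenvalue of the (real symmetric) signless Laplacian matrix. -/
noncomputable def signlessRadius {V : Type*} [Fintype V] (G : SimpleGraph V) : ℝ :=
  sSup (spectrum ℝ (signlessLaplacian G))

open Classical in
/-- `G` has a spanning `k`-tree: a spanning subgraph that is a tree of maximum degree
at most `k`. -/
def HasSpanningKTree {V : Type*} [Fintype V] (G : SimpleGraph V) (k : ℕ) : Prop :=
  ∃ T : SimpleGraph V, T ≤ G ∧ T.IsTree ∧ ∀ v : V, T.degree v ≤ k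

/-- The graph `K_{3t} ∨ (K_{n-3t(k-1)-2} ∪ (3t(k-2)+2) K_1)`. The subtractions are natural-number
subtractions; they do not truncate when `2 ≤ k` and `3t(k-1)+2 ≤ n`, and then the graph has `n`
vertices. -/
def extremalGraph (n k t : ℕ) :
    SimpleGraph (Fin (3 * t) ⊕ (Fin (n - 3 * t * (k - 1) - 2) ⊕ Fin (3 * t * (k - 2) + 2))) :=
  join (⊤ : SimpleGraph (Fin (3 * t)))
    (SimpleGraph.sum (⊤ : SimpleGraph (Fin (n - 3 * t * (k - 1) - 2)))
      (⊥ : SimpleGraph (Fin (3 * t * (k - 2) + 2))))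

end ToughKTree

/-!
The proof is by contradiction: if `G` has no spanning `k`-tree, then `q(G) < q(H)`. The exception
`G ≅ H` is never needed, since `H` itself has a spanning `k`-tree.

*Structure.* Among the spanning subgraphs of `G` of maximum degree at most `k`, a forest `F` whose
reachability relation is maximal is not connected. A minimal set `S` of vertices of full degree
outside of which every vertex is reducible (its degree can be lowered by changing its component of
`F - S` only) has the property that no edge of `G` joins two components of `F - S`: such an edge
would close a cycle through the vertices of `S` on a path of `F`, and these could be removed from
`S`. Counting edges of the forest gives Win's bound `c(G - S) ≥ (k - 2)|S| + 3`, and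
`c(G - S) ≥ (k - 1)|S| + 2` if `S` is independent; this is
`SimpleGraph.exists_finset_of_not_hasSpanningKTree`. Toughness excludes the second bound and turns
the first one into `|S| ≥ 3t`. Take `S` of maximum size and apply the result again to `G` without
the edges inside `S`. The set `S'` found there cannot contain `S`, so there is `u ∈ S` outside
`S'`; any two vertices of `S` that miss few vertices have a common neighbour, hence `S \ S'` lies
in a single component, and a vertex of each of the other components is a non-neighbour of `u`.
Therefore some vertex of `S` has non-neighbours outside `S`
(`SimpleGraph.exists_finset_with_nonneighbors`).

*Spectrum.* Write `s = |S|`, `a = (k - 2)s + 2` and `n = s + m + a`. A positive vector `w` with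
`Q w < μ w` shows `q(G) < μ`. Take `w = 1` on `S`, except for a smaller value at `u`, and
`σ / (μ - s - 2x + 2)` on a component of `G - S` of size `x`. By convexity, the total weight
outside `S` is largest for one component of size `m` and `a` single vertices
(`SimpleGraph.signlessRadius_lt_of_components`). For `μ` take the eigenvalue of `H` that belongs to
a vector constant on its three parts. For `s = 3t` the condition on `w` is the eigenvalue equation
of `H`, and the non-neighbour of `u` makes the inequality strict. For `s > 3t`, one non-neighbour
is enough if `t ≥ 2`, if `k ≤ 14`, or if `2n ≥ 11k` (`ToughKTree.signlessRadius_lt_of_large`). In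
the remaining case, `t = 1` and `k ≥ 15` and `2n < 11k`, the graph `K_s ∨ (K_m ∪ a K_1)` may have a
larger eigenvalue than `H`; but there `u` can be chosen with `k` non-neighbours outside `S`, its
weight can be lowered accordingly, and only `s ≤ 5` occurs
(`ToughKTree.signlessRadius_lt_of_small`).
-/

open Finset

/-! ### Forests and numbers of components -/

namespace SimpleGraph

theorem degree_eq_ncard_neighborSet {V : Type*} (G : SimpleGraph V) (v : V)
    [Fintype (G.neighborSet v)] : G.degree v = (G.neighborSet v).ncard := by
  rw [← card_neighborSet_eq_degree, Set.ncard_eq_toFinset_card', Set.toFinset_card]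

theorem sum_ncard_neighborSet {V : Type*} [Fintype V] (G : SimpleGraph V) :
    ∑ v, (G.neighborSet v).ncard = 2 * Nat.card G.edgeSet := by
  classical
  rw [Nat.card_eq_fintype_card, ← edgeFinset_card, ← sum_degrees_eq_twice_card_edges]
  exact Finset.sum_congr rfl fun v _ => (G.degree_eq_ncard_neighborSet v).symm

theorem ConnectedComponent.ncard_neighborSet_toSimpleGraph {V : Type*} {G : SimpleGraph V}
    (c : G.ConnectedComponent) (v : c) :
    (c.toSimpleGraph.neighborSet v).ncard = (G.neighborSet (v : V)).ncard := by
  rw [← Set.ncard_image_of_injective _ Subtype.val_injective]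
  congr 1
  ext w
  constructor
  · rintro ⟨w, hw, rfl⟩
    exact hw
  · intro hw
    exact ⟨⟨w, c.mem_supp_of_adj_mem_supp v.2 hw⟩, hw, rfl⟩

open Classical in
theorem sum_ncard_neighborSet_component {V : Type*} [Fintype V] {G : SimpleGraph V}
    (c : G.ConnectedComponent) :
    ∑ v with G.connectedComponentMk v = c, (G.neighborSet v).ncard =
      2 * Nat.card c.toSimpleGraph.edgeSet := by
  have : Fintype c := Fintype.ofFinite _
  rw [← sum_ncard_neighborSet]
  simp_rw [c.ncard_neighborSet_toSimpleGraph]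
  refine Finset.sum_subtype _ (fun v => ?_) _
  simp only [mem_filter_univ]
  exact Iff.rfl

open Classical in
theorem card_fiber_connectedComponentMk {V : Type*} [Fintype V] {G : SimpleGraph V}
    (c : G.ConnectedComponent) :
    #{v | G.connectedComponentMk v = c} = Nat.card c := by
  refine (Nat.subtype_card _ fun v => ?_).symm
  simp only [mem_filter_univ]
  exact Iff.rfl

theorem two_mul_card_le_sum_degrees_add {V : Type*} [Fintype V] (G : SimpleGraph V) :
    2 * Nat.card V ≤ ∑ v, (G.neighborSet v).ncard + 2 * ToughKTree.numComponents G := by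
  classical
  rw [Nat.card_eq_fintype_card, ← Finset.card_univ (α := V),
    Finset.card_eq_sum_card_fiberwise (f := G.connectedComponentMk) (t := univ) (by simp),
    ← Finset.sum_fiberwise Finset.univ G.connectedComponentMk, ToughKTree.numComponents,
    Nat.card_eq_fintype_card, ← Finset.card_univ, Finset.mul_sum, Finset.card_eq_sum_ones,
    Finset.mul_sum, ← Finset.sum_add_distrib]
  refine Finset.sum_le_sum fun c _ => ?_
  rw [sum_ncard_neighborSet_component, card_fiber_connectedComponentMk]
  have h := c.connected_toSimpleGraph.card_vert_le_card_edgeSet_add_one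
  omega

theorem IsAcyclic.sum_degrees_add {V : Type*} [Fintype V] {G : SimpleGraph V}
    (hG : G.IsAcyclic) :
    ∑ v, (G.neighborSet v).ncard + 2 * ToughKTree.numComponents G = 2 * Nat.card V := by
  classical
  rw [Nat.card_eq_fintype_card, ← Finset.card_univ (α := V),
    Finset.card_eq_sum_card_fiberwise (f := G.connectedComponentMk) (t := univ) (by simp),
    ← Finset.sum_fiberwise Finset.univ G.connectedComponentMk, ToughKTree.numComponents,
    Nat.card_eq_fintype_card, ← Finset.card_univ, Finset.mul_sum, Finset.card_eq_sum_ones,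
    Finset.mul_sum, ← Finset.sum_add_distrib]
  refine Finset.sum_congr rfl fun c _ => ?_
  rw [sum_ncard_neighborSet_component, card_fiber_connectedComponentMk]
  have : Fintype c := Fintype.ofFinite _
  have h := (isTree_iff_connected_and_card.1 (hG.isTree_connectedComponent c)).2
  omega

open Classical in
theorem sum_ncard_neighborSet_induce {V : Type*} [Fintype V] (G : SimpleGraph V) (A : Finset V)
    (B : Set V) (hB : B = A) [Fintype B] :
    ∑ v, ((G.induce B).neighborSet v).ncard = ∑ v ∈ A, #{w ∈ A | G.Adj v w} := by
  subst hB
  rw [Finset.sum_subtype A (p := fun x => x ∈ (A : Set V)) (fun x => by simp)]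
  refine Finset.sum_congr rfl fun v _ => ?_
  rw [← Set.ncard_image_of_injective _ Subtype.val_injective, ← Set.ncard_coe_finset]
  congr 1
  ext w
  simp only [Set.mem_image, mem_neighborSet, comap_adj, Function.Embedding.subtype_apply,
    Subtype.exists, coe_filter, Set.mem_ofPred_eq]
  constructor
  · rintro ⟨a, ha, h, rfl⟩
    exact ⟨by simpa using ha, h⟩
  · rintro ⟨h1, h2⟩
    exact ⟨w, by simpa using h1, h2, rfl⟩

/-- Deleting from a forest a nonempty set `S` of vertices of degree `k` leaves many components;
`k * #S` edge ends are lost, and those counted twice form a forest on `S`. -/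
theorem IsAcyclic.le_numComponents_deleteVertices {V : Type*} [Fintype V] {F : SimpleGraph V}
    (hF : F.IsAcyclic) {k : ℕ} {S : Finset V} (hS : S.Nonempty)
    (hdeg : ∀ v ∈ S, (F.neighborSet v).ncard = k) :
    (k * #S + ToughKTree.numComponents F + 1 ≤
      2 * #S + ToughKTree.numComponents (ToughKTree.deleteVertices F S)) ∧
    ((∀ u ∈ S, ∀ v ∈ S, ¬ F.Adj u v) → k * #S + ToughKTree.numComponents F ≤
      #S + ToughKTree.numComponents (ToughKTree.deleteVertices F S)) := by
  classical
  have e1 := hF.sum_degrees_add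
  have e2 := two_mul_card_le_sum_degrees_add (ToughKTree.deleteVertices F S)
  have e3 := (hF.induce (S : Set V)).sum_degrees_add
  rw [sum_ncard_neighborSet_induce F S _ rfl] at e3
  have e4 : ∑ v, ((ToughKTree.deleteVertices F S).neighborSet v).ncard =
      ∑ v ∈ Sᶜ, #{w ∈ Sᶜ | F.Adj v w} :=
    sum_ncard_neighborSet_induce F Sᶜ _ (by simp)
  have e5 : Nat.card ((S : Set V)ᶜ : Set V) = Nat.card V - #S := by
    rw [Nat.card_eq_fintype_card, Nat.card_eq_fintype_card, Fintype.card_compl_set]; simp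
  have hSV : #S ≤ Nat.card V := by
    rw [Nat.card_eq_fintype_card]; exact Finset.card_le_univ S
  have hspl : ∀ v, (F.neighborSet v).ncard = #{w ∈ S | F.Adj v w} + #{w ∈ Sᶜ | F.Adj v w} := by
    intro v
    rw [← Finset.card_union_of_disjoint, ← Set.ncard_coe_finset]
    · congr 1
      ext w
      by_cases h : w ∈ S <;> simp [h]
    · exact Finset.disjoint_filter_filter disjoint_compl_right
  have hX : ∑ v ∈ S, #{w ∈ Sᶜ | F.Adj v w} = ∑ v ∈ Sᶜ, #{w ∈ S | F.Adj v w} := by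
    simp_rw [Finset.card_filter]
    rw [Finset.sum_comm]
    simp_rw [F.adj_comm]
  have hk : ∑ v ∈ S, (F.neighborSet v).ncard = k * #S := by
    rw [Finset.sum_congr rfl hdeg, Finset.sum_const, smul_eq_mul, mul_comm]
  have hT : ∑ v, (F.neighborSet v).ncard =
      ∑ v ∈ S, (F.neighborSet v).ncard + ∑ v ∈ Sᶜ, (F.neighborSet v).ncard :=
    (Finset.sum_add_sum_compl S _).symm
  have h1 : ∑ v ∈ S, (F.neighborSet v).ncard
      = ∑ v ∈ S, #{w ∈ S | F.Adj v w} + ∑ v ∈ S, #{w ∈ Sᶜ | F.Adj v w} := by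
    rw [← Finset.sum_add_distrib]; exact Finset.sum_congr rfl fun v _ => hspl v
  have h2 : ∑ v ∈ Sᶜ, (F.neighborSet v).ncard
      = ∑ v ∈ Sᶜ, #{w ∈ S | F.Adj v w} + ∑ v ∈ Sᶜ, #{w ∈ Sᶜ | F.Adj v w} := by
    rw [← Finset.sum_add_distrib]; exact Finset.sum_congr rfl fun v _ => hspl v
  have hcS : Nat.card (S : Set V) = #S := by simp
  have hc1 : 1 ≤ ToughKTree.numComponents (F.induce (S : Set V)) := by
    obtain ⟨x, hx⟩ := hS
    have : Nonempty (F.induce (S : Set V)).ConnectedComponent :=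
      ⟨connectedComponentMk _ ⟨x, by simpa using hx⟩⟩
    exact Nat.card_pos
  constructor
  · omega
  · intro hind
    have : ∑ v ∈ S, #{w ∈ S | F.Adj v w} = 0 := by
      refine Finset.sum_eq_zero fun v hv => ?_
      rw [Finset.card_eq_zero, Finset.filter_eq_empty_iff]
      exact fun w hw => hind v hv w hw
    omega

end SimpleGraph

/-! ### Reducible vertices and exchange along a path -/

namespace SimpleGraph

variable {V : Type*}

/-- The spanning subgraph of `F` whose edges are the edges of `F` with both ends in `A`. -/
def within (F : SimpleGraph V) (A : Set V) : SimpleGraph V where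
  Adj a b := F.Adj a b ∧ a ∈ A ∧ b ∈ A
  symm := ⟨fun _ _ h => ⟨h.1.symm, h.2.2, h.2.1⟩⟩
  loopless := ⟨fun _ h => h.1.ne rfl⟩

theorem within_adj {F : SimpleGraph V} {A : Set V} {a b : V} :
    (F.within A).Adj a b ↔ F.Adj a b ∧ a ∈ A ∧ b ∈ A := Iff.rfl

theorem within_mono (F : SimpleGraph V) {A B : Set V} (h : A ⊆ B) : F.within A ≤ F.within B :=
  fun _ _ hab => ⟨hab.1, h hab.2.1, h hab.2.2⟩

theorem within_le (F : SimpleGraph V) (A : Set V) : F.within A ≤ F := fun _ _ h => h.1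

theorem Reachable.lift_adj {H K : SimpleGraph V} (h : ∀ a b, H.Adj a b → K.Reachable a b) {a b : V}
    (hab : H.Reachable a b) : K.Reachable a b := by
  rw [reachable_iff_reflTransGen] at hab
  induction hab with
  | refl => exact Reachable.refl _
  | tail _ hbc ih => exact ih.trans (h _ _ hbc)

/-- The vertices reachable from `z` in `F - S`, together with `z` itself (which matters only for
`z ∈ S`). -/
def compAvoiding (F : SimpleGraph V) (S : Set V) (z : V) : Set V :=
  {a | (F.within Sᶜ).Reachable z a}

theorem mem_compAvoiding {F : SimpleGraph V} {S : Set V} {z a : V} :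
    a ∈ F.compAvoiding S z ↔ (F.within Sᶜ).Reachable z a := Iff.rfl

theorem self_mem_compAvoiding (F : SimpleGraph V) (S : Set V) (z : V) :
    z ∈ F.compAvoiding S z := Reachable.refl _

theorem notMem_of_mem_compAvoiding {F : SimpleGraph V} {S : Set V} {z a : V} (hz : z ∉ S)
    (h : a ∈ F.compAvoiding S z) : a ∉ S := by
  rw [mem_compAvoiding, reachable_iff_reflTransGen] at h
  cases h with
  | refl => exact hz
  | tail _ hbc => exact hbc.2.2

theorem compAvoiding_anti (F : SimpleGraph V) {S T : Set V} (h : T ⊆ S) (z : V) :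
    F.compAvoiding S z ⊆ F.compAvoiding T z :=
  fun _ ha => Reachable.mono (within_mono F (Set.compl_subset_compl.2 h)) ha

/-- If every edge of `F` inside the component `C` of `z` in `F - S` is bridged by a connection in
`K`, then so is every pair `z, a` with `a ∈ C`. -/
theorem reachable_of_mem_compAvoiding {F K : SimpleGraph V} {S : Set V} {z : V}
    (h : ∀ a b, F.Adj a b → a ∈ F.compAvoiding S z → b ∈ F.compAvoiding S z → K.Reachable a b)
    {a : V} (ha : a ∈ F.compAvoiding S z) : K.Reachable z a := by
  have h' := ha
  rw [mem_compAvoiding, reachable_iff_reflTransGen] at h'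
  clear ha
  induction h' with
  | refl => exact Reachable.refl _
  | @tail b c hab hbc ih =>
    have hb : b ∈ F.compAvoiding S z := (reachable_iff_reflTransGen _ _).2 hab
    have hc : c ∈ F.compAvoiding S z := hb.trans hbc.reachable
    exact ih.trans (h _ _ hbc.1 hb hc)

/-- `F` is a spanning subgraph of `G` of maximum degree at most `k`. The degree is taken as an
`ncard`, so that no decidability is involved. -/
def IsDegreeBoundedIn (G : SimpleGraph V) (k : ℕ) (F : SimpleGraph V) : Prop :=
  F ≤ G ∧ ∀ v, (F.neighborSet v).ncard ≤ k

/-- The degree of `z` in `F` can be made less than `k` by changing the edges of `F` inside the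
component `C` of `z` in `F - S` only, keeping `C` connected and all degrees at most `k`. -/
def IsReducible (G : SimpleGraph V) (k : ℕ) (F : SimpleGraph V) (S : Set V) (z : V) : Prop :=
  ∃ F' : SimpleGraph V, IsDegreeBoundedIn G k F' ∧ (F'.neighborSet z).ncard < k ∧
    (∀ a b, ¬ (a ∈ F.compAvoiding S z ∧ b ∈ F.compAvoiding S z) → (F'.Adj a b ↔ F.Adj a b)) ∧
    ∀ a ∈ F.compAvoiding S z, (F'.within (F.compAvoiding S z)).Reachable z a

theorem IsReducible.anti {G : SimpleGraph V} {k : ℕ} {F : SimpleGraph V} {S T : Set V} (h : T ⊆ S)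
    {z : V} (hz : IsReducible G k F S z) : IsReducible G k F T z := by
  obtain ⟨F', hb, hd, hoff, hin⟩ := hz
  have hC := F.compAvoiding_anti h z
  refine ⟨F', hb, hd, fun a b hab => hoff a b fun h' => hab ⟨hC h'.1, hC h'.2⟩, fun a ha => ?_⟩
  refine reachable_of_mem_compAvoiding (fun a b hab ha hb => ?_) ha
  by_cases hc : a ∈ F.compAvoiding S z ∧ b ∈ F.compAvoiding S z
  · exact (((hin a hc.1).symm.trans (hin b hc.2))).mono (within_mono _ hC)
  · exact Adj.reachable ⟨(hoff a b hc).2 hab, ha, hb⟩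

/-- Replace the edges of `F` inside `C` by those of `K`. -/
def patch (F K : SimpleGraph V) (C : Set V) : SimpleGraph V where
  Adj a b := (a ∈ C ∧ b ∈ C ∧ K.Adj a b) ∨ (¬ (a ∈ C ∧ b ∈ C) ∧ F.Adj a b)
  symm := ⟨fun a b h => by
    rcases h with h | h
    · exact Or.inl ⟨h.2.1, h.1, h.2.2.symm⟩
    · exact Or.inr ⟨fun h' => h.1 h'.symm, h.2.symm⟩⟩
  loopless := ⟨fun a h => by
    rcases h with h | h
    · exact h.2.2.ne rfl
    · exact h.2.ne rfl⟩

theorem patch_adj {F K : SimpleGraph V} {C : Set V} {a b : V} : (patch F K C).Adj a b ↔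
    (a ∈ C ∧ b ∈ C ∧ K.Adj a b) ∨ (¬ (a ∈ C ∧ b ∈ C) ∧ F.Adj a b) := Iff.rfl

/-- Two reductions in different components of `F - S` can be carried out at the same time. -/
theorem exists_reduce_pair {G : SimpleGraph V} {k : ℕ} {F : SimpleGraph V} {S : Set V} {x y : V}
    (hx : IsReducible G k F S x) (hy : IsReducible G k F S y) (hxy : y ∉ F.compAvoiding S x) :
    ∃ F', IsDegreeBoundedIn G k F' ∧ (F'.neighborSet x).ncard < k ∧ (F'.neighborSet y).ncard < k ∧
      (∀ a b, ¬ (a ∈ F.compAvoiding S x ∧ b ∈ F.compAvoiding S x) →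
        ¬ (a ∈ F.compAvoiding S y ∧ b ∈ F.compAvoiding S y) → (F'.Adj a b ↔ F.Adj a b)) ∧
      (∀ a ∈ F.compAvoiding S x, (F'.within (F.compAvoiding S x)).Reachable x a) ∧
      (∀ a ∈ F.compAvoiding S y, (F'.within (F.compAvoiding S y)).Reachable y a) := by
  obtain ⟨F₁, hb₁, hd₁, hoff₁, hin₁⟩ := hx
  obtain ⟨F₂, hb₂, hd₂, hoff₂, hin₂⟩ := hy
  have hdis : ∀ a, a ∈ F.compAvoiding S x → a ∉ F.compAvoiding S y :=
    fun a ha hb => hxy (Reachable.trans ha (Reachable.symm hb))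
  set X := F.compAvoiding S x
  set Y := F.compAvoiding S y
  have hnY : ∀ a ∈ Y, (patch F₁ F₂ Y).neighborSet a = F₂.neighborSet a := by
    intro a ha
    ext b
    simp only [mem_neighborSet, patch_adj]
    by_cases hb : b ∈ Y
    · simp [ha, hb]
    · have h1 := hoff₁ a b fun h => hdis a h.1 ha
      have h2 := hoff₂ a b fun h => hb h.2
      simp [ha, hb, h1, h2]
  have hn : ∀ a, a ∉ Y → (patch F₁ F₂ Y).neighborSet a = F₁.neighborSet a := by
    intro a ha
    ext b
    simp [mem_neighborSet, patch_adj, ha]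
  have hxX : x ∈ X := self_mem_compAvoiding F S x
  have hyY : y ∈ Y := self_mem_compAvoiding F S y
  refine ⟨patch F₁ F₂ Y, ⟨?_, fun v => ?_⟩, ?_, ?_, ?_, ?_, ?_⟩
  · rintro a b (h | h)
    · exact hb₂.1 h.2.2
    · exact hb₁.1 h.2
  · by_cases hv : v ∈ Y
    · rw [hnY v hv]; exact hb₂.2 v
    · rw [hn v hv]; exact hb₁.2 v
  · rw [hn x (hdis x hxX)]; exact hd₁
  · rw [hnY y hyY]; exact hd₂
  · intro a b h1 h2
    rw [patch_adj]
    have := hoff₁ a b h1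
    tauto
  · intro a ha
    have hle : F₁.within X ≤ (patch F₁ F₂ Y).within X := fun c d hcd =>
      ⟨Or.inr ⟨fun h => hdis c hcd.2.1 h.1, hcd.1⟩, hcd.2⟩
    exact (hin₁ a ha).mono hle
  · intro a ha
    have hle : F₂.within Y ≤ (patch F₁ F₂ Y).within Y := fun c d hcd =>
      ⟨Or.inl ⟨hcd.2.1, hcd.2.2, hcd.1⟩, hcd.2⟩
    exact (hin₂ a ha).mono hle

theorem Walk.reachable_of_forall_edges {F K : SimpleGraph V} {A : Set V} {e : Sym2 V}
    (h : ∀ a b, F.Adj a b → a ∈ A → b ∈ A → s(a, b) ≠ e → K.Reachable a b) {x y : V}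
    (p : F.Walk x y) (hp : ∀ a ∈ p.support, a ∈ A) (he : e ∉ p.edges) : K.Reachable x y := by
  induction p with
  | nil => exact Reachable.refl _
  | cons hab q ih =>
    rw [Walk.edges_cons, List.mem_cons, not_or] at he
    refine (h _ _ hab (hp _ (by simp)) (hp _ (by simp)) fun h => he.1 h.symm).trans
      (ih (fun a ha => hp a (by simp [ha])) he.2)

/-- A path splits at an inner vertex `z` into a part up to `z`, an edge `zz'` that is not used
again, and a part from `z'` on. -/
theorem Walk.IsPath.exists_split {F : SimpleGraph V} {x y z : V} {p : F.Walk x y} (hp : p.IsPath)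
    (hz : z ∈ p.support) (hzy : z ≠ y) :
    ∃ z', F.Adj z z' ∧ ∃ (p₁ : F.Walk x z) (p₂ : F.Walk z' y),
      s(z, z') ∉ p₁.edges ∧ s(z, z') ∉ p₂.edges ∧ (∀ a ∈ p₁.support, a ∈ p.support) ∧
      ∀ a ∈ p₂.support, a ∈ p.support := by
  induction p with
  | nil => simp at hz; exact absurd hz hzy
  | @cons u v w hab q ih =>
    rw [Walk.cons_isPath_iff] at hp
    rw [Walk.support_cons, List.mem_cons] at hz
    by_cases hzu : z = u
    · subst hzu
      refine ⟨v, hab, Walk.nil, q, by simp, fun h => hp.2 (q.fst_mem_support_of_mem_edges h),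
        by simp, fun a ha => by simp [ha]⟩
    · obtain ⟨z', hzz', p₁, p₂, h1, h2, h3, h4⟩ := ih hp.1 (hz.resolve_left hzu) hzy
      refine ⟨z', hzz', Walk.cons hab p₁, p₂, ?_, h2, ?_, fun a ha => by simp [h4 a ha]⟩
      · rw [Walk.edges_cons, List.mem_cons, not_or]
        refine ⟨fun h => ?_, h1⟩
        rcases Sym2.eq_iff.1 h with h | h
        · exact hzu h.1
        · exact hp.2 (h.2 ▸ h4 _ p₂.start_mem_support)
      · intro a ha
        rw [Walk.support_cons, List.mem_cons] at ha ⊢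
        exact ha.imp id (h3 a)

theorem ncard_neighborSet_sup_edge_le [Finite V] (F : SimpleGraph V) (x y v : V) :
    ((F ⊔ edge x y).neighborSet v).ncard ≤ (F.neighborSet v).ncard + 1 := by
  classical
  have : (F ⊔ edge x y).neighborSet v ⊆ insert (if v = x then y else x) (F.neighborSet v) := by
    intro b hb
    rw [mem_neighborSet, sup_adj, edge_adj] at hb
    rw [Set.mem_insert_iff]
    rcases hb with hb | ⟨⟨rfl, rfl⟩ | ⟨rfl, rfl⟩, h⟩
    · exact Or.inr hb
    · simp
    · simp [h]
  exact (Set.ncard_le_ncard this (Set.toFinite _)).trans (Set.ncard_insert_le _ _)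

theorem neighborSet_sup_edge_of_ne (F : SimpleGraph V) {x y v : V} (hx : v ≠ x) (hy : v ≠ y) :
    (F ⊔ edge x y).neighborSet v = F.neighborSet v := by
  ext b
  rw [mem_neighborSet, mem_neighborSet, sup_adj, edge_adj]
  tauto

/-- Suppose that `F` has maximal reachability and that everything outside `S` is reducible. If an
edge `xy` of `G` joins two components of `F - S`, then `S` can be shrunk: reduce `x` and `y` and add
`xy`. By maximality `x` and `y` are joined by a path of `F`, and at each vertex of `S` on this path
a path edge can be deleted instead, so such vertices can be removed from `S`. -/
theorem exists_smaller_of_adj [Finite V] {G : SimpleGraph V} {k : ℕ} {F : SimpleGraph V}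
    (hF : IsDegreeBoundedIn G k F)
    (hmax : ∀ F', IsDegreeBoundedIn G k F' → F.Reachable ≤ F'.Reachable →
      F'.Reachable ≤ F.Reachable)
    {S : Set V} (hS : ∀ z, z ∉ S → IsReducible G k F S z) {x y : V} (hx : x ∉ S) (hy : y ∉ S)
    (hxy : G.Adj x y) (hcomp : y ∉ F.compAvoiding S x) :
    ∃ T ⊂ S, ∀ z, z ∉ T → IsReducible G k F T z := by
  obtain ⟨F₁, hb, hdx, hdy, hoff, hinx, hiny⟩ := exists_reduce_pair (hS x hx) (hS y hy) hcomp
  have hdeg : ∀ v, ((F₁ ⊔ edge x y).neighborSet v).ncard ≤ k := by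
    intro v
    by_cases h : v = x ∨ v = y
    · have := ncard_neighborSet_sup_edge_le F₁ x y v
      rcases h with rfl | rfl <;> omega
    · rw [not_or] at h
      rw [neighborSet_sup_edge_of_ne _ h.1 h.2]
      exact hb.2 v
  have hle : F₁ ⊔ edge x y ≤ G := by
    refine sup_le hb.1 ?_
    intro a b hab
    rw [edge_adj] at hab
    rcases hab.1 with ⟨rfl, rfl⟩ | ⟨rfl, rfl⟩
    · exact hxy
    · exact hxy.symm
  have hedge : (edge x y).Adj x y := by rw [edge_adj]; exact ⟨Or.inl ⟨rfl, rfl⟩, hxy.ne⟩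
  have hreach : F.Reachable x y := by
    refine hmax _ ⟨hle, hdeg⟩ ?_ x y (Adj.reachable (Or.inr hedge))
    intro a b hab
    refine Reachable.mono le_sup_left (hab.lift_adj fun a b hab => ?_)
    by_cases h1 : a ∈ F.compAvoiding S x ∧ b ∈ F.compAvoiding S x
    · exact ((hinx a h1.1).symm.trans (hinx b h1.2)).mono (within_le _ _)
    by_cases h2 : a ∈ F.compAvoiding S y ∧ b ∈ F.compAvoiding S y
    · exact ((hiny a h2.1).symm.trans (hiny b h2.2)).mono (within_le _ _)
    exact ((hoff a b h1 h2).2 hab).reachable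
  obtain ⟨p, hp⟩ := hreach.exists_isPath
  set R : Set V := {a | a ∈ p.support} with hR
  have hwithin : ∀ B : Set V, (∀ a ∈ p.support, a ∈ B) → ∀ a ∈ p.support,
      (F.within B).Reachable x a := by
    classical
    intro B hB a ha
    have h0 : s(x, x) ∉ (p.takeUntil a ha).edges := fun h =>
      (F.loopless.irrefl x) ((p.takeUntil a ha).adj_of_mem_edges h)
    exact (p.takeUntil a ha).reachable_of_forall_edges (A := B) (e := s(x, x))
      (fun c d hcd hc hd _ => Adj.reachable (within_adj.2 ⟨hcd, hc, hd⟩))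
      (fun c hc => hB c (p.support_takeUntil_subset_support ha hc)) h0
  refine ⟨S \ R, ⟨Set.sdiff_subset, fun hsub => ?_⟩, fun z hz => ?_⟩
  · refine hcomp (hwithin Sᶜ (fun a ha haS => (hsub haS).2 ha) y p.end_mem_support)
  by_cases hzS : z ∉ S
  · exact (hS z hzS).anti Set.sdiff_subset
  rw [not_not] at hzS
  have hzR : z ∈ p.support := by
    by_contra h
    exact hz ⟨hzS, h⟩
  have hzx : z ≠ x := fun h => hx (h ▸ hzS)
  have hzy : z ≠ y := fun h => hy (h ▸ hzS)
  obtain ⟨z', hzz', p₁, p₂, he1, he2, hs1, hs2⟩ := hp.exists_split hzR hzy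
  set C := F.compAvoiding (S \ R) z with hC
  have hpC : ∀ a ∈ p.support, a ∈ C := by
    have hR' : ∀ a ∈ p.support, a ∈ (S \ R)ᶜ := fun a ha h => h.2 ha
    exact fun a ha => (hwithin _ hR' z hzR).symm.trans (hwithin _ hR' a ha)
  have hXC : F.compAvoiding S x ⊆ C := fun a ha =>
    (hpC x p.start_mem_support).trans (F.compAvoiding_anti Set.sdiff_subset x ha)
  have hYC : F.compAvoiding S y ⊆ C := fun a ha =>
    (hpC y p.end_mem_support).trans (F.compAvoiding_anti Set.sdiff_subset y ha)
  have hzX : z ∉ F.compAvoiding S x := fun h => notMem_of_mem_compAvoiding hx h hzS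
  have hzY : z ∉ F.compAvoiding S y := fun h => notMem_of_mem_compAvoiding hy h hzS
  -- the new edge `xy` closes a cycle through `zz'`, so `zz'` is not needed to keep `C` connected
  set F₂ := (F₁ ⊔ edge x y).deleteEdges {s(z, z')} with hF₂
  have hadj₂ : ∀ a b, F₂.Adj a b ↔ (F₁ ⊔ edge x y).Adj a b ∧ s(a, b) ≠ s(z, z') := by
    intro a b
    rw [hF₂, deleteEdges_adj, Set.mem_singleton_iff]
  have hnz : F₁.neighborSet z = F.neighborSet z := by
    ext b
    exact hoff z b (fun h => hzX h.1) (fun h => hzY h.1)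
  have hstep : ∀ a b, F.Adj a b → a ∈ C → b ∈ C → s(a, b) ≠ s(z, z') →
      (F₂.within C).Reachable a b := by
    intro a b hab ha hb' hne
    have hsub : ∀ {D : Set V}, D ⊆ C → z ∉ D → F₁.within D ≤ F₂.within C := by
      intro D hD hzD c d hcd
      refine ⟨(hadj₂ c d).2 ⟨Or.inl hcd.1, fun h => ?_⟩, hD hcd.2.1, hD hcd.2.2⟩
      rcases Sym2.eq_iff.1 h with h | h
      · exact hzD (h.1 ▸ hcd.2.1)
      · exact hzD (h.2 ▸ hcd.2.2)
    by_cases h1 : a ∈ F.compAvoiding S x ∧ b ∈ F.compAvoiding S x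
    · exact ((hinx a h1.1).symm.trans (hinx b h1.2)).mono (hsub hXC hzX)
    by_cases h2 : a ∈ F.compAvoiding S y ∧ b ∈ F.compAvoiding S y
    · exact ((hiny a h2.1).symm.trans (hiny b h2.2)).mono (hsub hYC hzY)
    exact Adj.reachable ⟨(hadj₂ a b).2 ⟨Or.inl ((hoff a b h1 h2).2 hab), hne⟩, ha, hb'⟩
  have hxy₂ : (F₂.within C).Adj x y := by
    refine ⟨(hadj₂ x y).2 ⟨Or.inr hedge, fun h => ?_⟩, hpC x p.start_mem_support,
      hpC y p.end_mem_support⟩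
    rcases Sym2.eq_iff.1 h with h | h
    · exact hzx h.1.symm
    · exact hzy h.2.symm
  have hround : (F₂.within C).Reachable z z' := by
    have r1 := p₁.reachable_of_forall_edges hstep (fun a ha => hpC a (hs1 a ha)) he1
    have r2 := p₂.reachable_of_forall_edges hstep (fun a ha => hpC a (hs2 a ha)) he2
    exact r1.symm.trans (hxy₂.reachable.trans r2.symm)
  have hsubnb : ∀ v, F₂.neighborSet v ⊆ (F₁ ⊔ edge x y).neighborSet v :=
    fun v b hb => ((hadj₂ v b).1 hb).1
  refine ⟨F₂, ⟨(deleteEdges_le _).trans hle, fun v => ?_⟩, ?_, ?_, ?_⟩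
  · exact (Set.ncard_le_ncard (hsubnb v) (Set.toFinite _)).trans (hdeg v)
  · have hss : F₂.neighborSet z ⊂ F.neighborSet z := by
      refine ⟨fun b hb => ?_, fun h => ?_⟩
      · have := hsubnb z hb
        rwa [neighborSet_sup_edge_of_ne _ hzx hzy, hnz] at this
      · exact ((hadj₂ z z').1 (h hzz')).2 rfl
    exact (Set.ncard_lt_ncard hss (Set.toFinite _)).trans_le (hF.2 z)
  · intro a b hab
    have hz' : z' ∈ C := hpC z' (hs2 z' p₂.start_mem_support)
    have hzC : z ∈ C := hpC z hzR
    have h1 : s(a, b) ≠ s(z, z') := by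
      intro h
      rcases Sym2.eq_iff.1 h with ⟨rfl, rfl⟩ | ⟨rfl, rfl⟩
      · exact hab ⟨hzC, hz'⟩
      · exact hab ⟨hz', hzC⟩
    have h2 : ¬ (edge x y).Adj a b := by
      intro h
      rw [edge_adj] at h
      rcases h.1 with ⟨rfl, rfl⟩ | ⟨rfl, rfl⟩
      · exact hab ⟨hpC _ p.start_mem_support, hpC _ p.end_mem_support⟩
      · exact hab ⟨hpC _ p.end_mem_support, hpC _ p.start_mem_support⟩
    rw [hadj₂, sup_adj]
    have := hoff a b (fun h => hab ⟨hXC h.1, hXC h.2⟩) (fun h => hab ⟨hYC h.1, hYC h.2⟩)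
    tauto
  · intro a ha
    refine reachable_of_mem_compAvoiding (fun c d hcd hc hd => ?_) ha
    by_cases h : s(c, d) = s(z, z')
    · rcases Sym2.eq_iff.1 h with ⟨rfl, rfl⟩ | ⟨rfl, rfl⟩
      · exact hround
      · exact hround.symm
    · exact hstep c d hcd hc hd h

end SimpleGraph

/-! ### Win's theorem on spanning trees of bounded degree -/

namespace SimpleGraph

variable {V : Type*}

theorem reachable_deleteVertices_of_within {F : SimpleGraph V} {S : Finset V} {a b : V}
    (h : (F.within (S : Set V)ᶜ).Reachable a b) (ha : a ∈ ((S : Set V)ᶜ : Set V)) :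
    ∃ hb : b ∈ ((S : Set V)ᶜ : Set V),
      (ToughKTree.deleteVertices F S).Reachable ⟨a, ha⟩ ⟨b, hb⟩ := by
  rw [reachable_iff_reflTransGen] at h
  induction h with
  | refl => exact ⟨ha, Reachable.refl _⟩
  | tail _ hbc ih =>
    obtain ⟨hb, hr⟩ := ih
    exact ⟨hbc.2.2, hr.trans (Adj.reachable hbc.1)⟩

theorem numComponents_le_of_reachable {W : Type*} [Finite W] {H K : SimpleGraph W}
    (h : ∀ a b, H.Adj a b → K.Reachable a b) :
    ToughKTree.numComponents K ≤ ToughKTree.numComponents H := by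
  refine Nat.card_le_card_of_surjective
    (ConnectedComponent.lift (fun v => K.connectedComponentMk v) ?_) ?_
  · intro v w p _
    exact ConnectedComponent.sound (p.reachable.lift_adj h)
  · intro c
    induction c using ConnectedComponent.ind with
    | h v => exact ⟨H.connectedComponentMk v, rfl⟩

/-- A strengthening of a theorem of Win: a connected graph without a spanning `k`-tree has a
nonempty set `S` with `c(G - S) ≥ (k - 2)|S| + 3`, and even `c(G - S) ≥ (k - 1)|S| + 2` in case `S`
is independent. -/
theorem exists_finset_of_not_hasSpanningKTree [Fintype V] {G : SimpleGraph V} {k : ℕ}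
    (hG : G.Connected) (hk : ¬ ToughKTree.HasSpanningKTree G k) :
    ∃ S : Finset V, S.Nonempty ∧
      k * #S + 3 ≤ 2 * #S + ToughKTree.numComponents (ToughKTree.deleteVertices G S) ∧
      ((∀ u ∈ S, ∀ v ∈ S, ¬ G.Adj u v) →
        k * #S + 2 ≤ #S + ToughKTree.numComponents (ToughKTree.deleteVertices G S)) := by
  classical
  obtain ⟨F₀, hF₀, hmax₀⟩ := Set.Finite.exists_maximalFor
    (fun F : SimpleGraph V => {p : V × V | F.Reachable p.1 p.2})
    {F | IsDegreeBoundedIn G k F} (Set.toFinite _)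
    ⟨⊥, bot_le, fun v => by simp [neighborSet]⟩
  obtain ⟨F, hFF₀, hac, hreach⟩ := F₀.exists_isAcyclic_reachable_eq_le
  have hF : IsDegreeBoundedIn G k F := by
    refine ⟨hFF₀.trans hF₀.1, fun v => le_trans (Set.ncard_le_ncard ?_ (Set.toFinite _)) (hF₀.2 v)⟩
    exact fun b hb => hFF₀ hb
  have hmax : ∀ F', IsDegreeBoundedIn G k F' → F.Reachable ≤ F'.Reachable →
      F'.Reachable ≤ F.Reachable := by
    intro F' hF' hle a b hab
    rw [hreach] at hle ⊢
    exact hmax₀ hF' (fun p hp => hle _ _ hp) (show (a, b) ∈ _ from hab)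
  -- `S` is a minimal set of vertices of full degree outside of which everything is reducible
  set P : Finset V → Prop := fun S => (∀ v ∈ S, (F.neighborSet v).ncard = k) ∧
    ∀ z, z ∉ (S : Set V) → IsReducible G k F S z with hP
  have hP₀ : P {v | (F.neighborSet v).ncard = k} := by
    refine ⟨fun v hv => by simpa using hv, fun z hz => ?_⟩
    refine ⟨F, hF, ?_, fun _ _ _ => Iff.rfl, fun a ha => ?_⟩
    · refine lt_of_le_of_ne (hF.2 z) fun h => hz ?_
      simpa using h
    · exact reachable_of_mem_compAvoiding
        (fun c d hcd hc hd => Adj.reachable (within_adj.2 ⟨hcd, hc, hd⟩)) ha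
  obtain ⟨S, -, hS⟩ := exists_minimal_le_of_wellFoundedLT P _ hP₀
  have hcross : ∀ x y, x ∉ S → y ∉ S → G.Adj x y → (F.within (S : Set V)ᶜ).Reachable x y := by
    intro x y hx hy hxy
    by_contra hcon
    obtain ⟨T, hTS, hT⟩ := exists_smaller_of_adj hF hmax hS.prop.2 (by simpa using hx)
      (by simpa using hy) hxy hcon
    have hTc : ((T.toFinset : Finset V) : Set V) = T := Set.coe_toFinset T
    have hT' : T.toFinset ≤ S := by
      intro v hv
      have := hTS.1 (by simpa using hv)
      simpa using this
    have hPT : P T.toFinset := by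
      refine ⟨fun v hv => hS.prop.1 v (hT' hv), ?_⟩
      rw [hTc]
      exact hT
    have := hS.le_of_le hPT hT'
    refine hTS.2 fun v hv => ?_
    have := this (show v ∈ S from by simpa using hv)
    simpa using this
  have hnc : ¬ F.Connected := fun hc => hk ⟨F, hF.1, ⟨hc, hac⟩, fun v => by
    rw [degree_eq_ncard_neighborSet]; exact hF.2 v⟩
  have hne : Nonempty V := hG.nonempty
  have hnr : ∃ a b, ¬ F.Reachable a b := by
    by_contra h
    push Not at h
    exact hnc ⟨h⟩
  have hSne : S.Nonempty := by
    rw [Finset.nonempty_iff_ne_empty]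
    rintro rfl
    obtain ⟨a, b, hab⟩ := hnr
    refine hab ((hG.preconnected a b).lift_adj fun c d hcd => ?_)
    exact (hcross c d (by simp) (by simp) hcd).mono (within_le _ _)
  have h2 : 2 ≤ ToughKTree.numComponents F := by
    obtain ⟨a, b, hab⟩ := hnr
    have : Nontrivial F.ConnectedComponent :=
      ⟨F.connectedComponentMk a, F.connectedComponentMk b, fun h =>
        hab (ConnectedComponent.exact h)⟩
    exact Finite.one_lt_card
  have hle : ToughKTree.numComponents (ToughKTree.deleteVertices F S) ≤
      ToughKTree.numComponents (ToughKTree.deleteVertices G S) := by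
    refine numComponents_le_of_reachable fun a b hab => ?_
    obtain ⟨_, h⟩ := reachable_deleteVertices_of_within
      (hcross a b (fun h => a.2 (mem_coe.2 h)) (fun h => b.2 (mem_coe.2 h)) hab) a.2
    exact h
  obtain ⟨c1, c2⟩ := hac.le_numComponents_deleteVertices hSne hS.prop.1
  refine ⟨S, hSne, by omega, fun hind => ?_⟩
  have := c2 fun u hu v hv h => hind u hu v hv (hF.1 h)
  omega

end SimpleGraph

/-! ### Tough graphs and non-neighbours -/

namespace SimpleGraph

variable {V : Type*}

theorem numComponents_deleteVertices_add_card_le [Fintype V] (G : SimpleGraph V) (S : Finset V) :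
    ToughKTree.numComponents (ToughKTree.deleteVertices G S) + #S ≤ Fintype.card V := by
  classical
  have h1 : ToughKTree.numComponents (ToughKTree.deleteVertices G S) ≤
      Nat.card ((S : Set V)ᶜ : Set V) :=
    Nat.card_le_card_of_surjective (connectedComponentMk _) Quot.mk_surjective
  have h2 : Nat.card ((S : Set V)ᶜ : Set V) = Fintype.card V - #S := by
    rw [Nat.card_eq_fintype_card, Fintype.card_compl_set]; simp
  have h3 := Finset.card_le_univ S
  omega

/-- The toughness condition, cleared of denominators and subtractions. -/
theorem mul_numComponents_le_of_isTough {G : SimpleGraph V} {k t : ℕ} (hk : 2 ≤ k)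
    (h : ToughKTree.IsTough G ((t : ℝ) / ((t : ℝ) * ((k : ℝ) - 2) + 1))) {S : Finset V}
    (hS : 2 ≤ ToughKTree.numComponents (ToughKTree.deleteVertices G S)) :
    t * ToughKTree.numComponents (ToughKTree.deleteVertices G S) + 2 * t * #S ≤
      #S * t * k + #S := by
  have h1 := h S hS
  have hk' : (2 : ℝ) ≤ k := by exact_mod_cast hk
  have hpos : (0 : ℝ) < (t : ℝ) * ((k : ℝ) - 2) + 1 := by
    have := mul_nonneg (Nat.cast_nonneg t) (sub_nonneg.2 hk')
    linarith
  rw [div_mul_eq_mul_div, div_le_iff₀ hpos] at h1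
  have h2 : (t : ℝ) * ToughKTree.numComponents (ToughKTree.deleteVertices G S) + 2 * t * #S ≤
      #S * t * k + #S := by linarith
  exact_mod_cast h2

/-- The graph obtained from `G` by deleting the edges inside `S`. -/
def removeInside (G : SimpleGraph V) (S : Finset V) : SimpleGraph V where
  Adj a b := G.Adj a b ∧ ¬ (a ∈ S ∧ b ∈ S)
  symm := ⟨fun _ _ h => ⟨h.1.symm, fun h' => h.2 h'.symm⟩⟩
  loopless := ⟨fun _ h => h.1.ne rfl⟩

theorem removeInside_le (G : SimpleGraph V) (S : Finset V) : G.removeInside S ≤ G :=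
  fun _ _ h => h.1

open Classical in
/-- In a tough graph without a spanning `k`-tree, Win's condition fails for a set `S` with a vertex
that has many non-neighbours outside `S`. Here `S` is taken of maximum size, and the refined form of
Win's theorem is applied to the graph without the edges inside `S`. -/
theorem exists_finset_with_nonneighbors [Fintype V] {G : SimpleGraph V}
    {k t N : ℕ} (hk : 3 ≤ k) (ht : 1 ≤ t) (hG : G.Connected)
    (htough : ToughKTree.IsTough G ((t : ℝ) / ((t : ℝ) * ((k : ℝ) - 2) + 1)))
    (hN : N + 1 ≤ k)
    (hcard : 2 * k * N + 3 * Fintype.card V < k * Fintype.card V + 6 + 2 * N)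
    (htree : ¬ ToughKTree.HasSpanningKTree G k) :
    ∃ S : Finset V, k * #S + 3 ≤
        2 * #S + ToughKTree.numComponents (ToughKTree.deleteVertices G S) ∧
      3 * t ≤ #S ∧ ∃ u ∈ S, N + 1 ≤ #{v | v ∉ S ∧ ¬ G.Adj u v} := by
  set P : Finset V → Prop := fun S => S.Nonempty ∧
    k * #S + 3 ≤ 2 * #S + ToughKTree.numComponents (ToughKTree.deleteVertices G S) with hP
  obtain ⟨S₀, hS₀, hS₀c, -⟩ := exists_finset_of_not_hasSpanningKTree hG htree
  obtain ⟨S, hS, hSmax⟩ := Set.Finite.exists_maximalFor (fun S : Finset V => #S) {S | P S}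
    (Set.toFinite _) ⟨S₀, hS₀, hS₀c⟩
  have hSmax' : ∀ T, P T → #T ≤ #S := fun T hT => by
    by_contra hlt
    exact hlt (hSmax hT (not_le.1 hlt).le)
  obtain ⟨hSne, hSc⟩ := hS
  -- sizes
  have hks : 3 * #S ≤ k * #S := Nat.mul_le_mul_right _ hk
  have hSpos : 1 ≤ #S := hSne.card_pos
  have htgh := mul_numComponents_le_of_isTough (by omega) htough (S := S) (by omega)
  have hSt : 3 * t ≤ #S := by
    have := Nat.mul_le_mul_left t hSc
    nlinarith
  have hSn := numComponents_deleteVertices_add_card_le G S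
  refine ⟨S, hSc, hSt, ?_⟩
  by_contra hcon
  push Not at hcon
  -- two vertices of `S` have a common neighbour in every large set outside `S`
  have hcommon : ∀ u ∈ S, ∀ v ∈ S, ∀ B : Finset V, Disjoint B S → 2 * N < #B →
      ∃ w ∈ B, G.Adj u w ∧ G.Adj v w := by
    intro u hu v hv B hBS hB
    by_contra hno
    push Not at hno
    have hsub : B ⊆ ({v | v ∉ S ∧ ¬ G.Adj u v} : Finset V) ∪
        ({w | w ∉ S ∧ ¬ G.Adj v w} : Finset V) := by
      intro w hw
      have hwS : w ∉ S := Finset.disjoint_left.1 hBS hw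
      have := hno w hw
      simp only [mem_union, mem_filter_univ]
      tauto
    have h1 := Finset.card_le_card hsub
    have h2 := Finset.card_union_le ({v | v ∉ S ∧ ¬ G.Adj u v} : Finset V) {w | w ∉ S ∧ ¬ G.Adj v w}
    have h3 := hcon u hu
    have h4 := hcon v hv
    omega
  have hadj : ∀ {a b}, G.Adj a b → ¬ (a ∈ S ∧ b ∈ S) → (G.removeInside S).Adj a b :=
    fun h1 h2 => ⟨h1, h2⟩
  have hG'conn : (G.removeInside S).Connected := by
    obtain ⟨u₀, hu₀⟩ := hSne
    rw [connected_iff_exists_forall_reachable]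
    refine ⟨u₀, fun a => ?_⟩
    have hreach := hG.preconnected u₀ a
    rw [reachable_iff_reflTransGen] at hreach
    induction hreach with
    | refl => exact Reachable.refl _
    | @tail b c _ hbc ih =>
      by_cases h : b ∈ S ∧ c ∈ S
      · have hlarge : 2 * N < #Sᶜ := by
          rw [Finset.card_compl]
          have : 3 * (k - 2) ≤ #S * (k - 2) := Nat.mul_le_mul_right _ (by omega)
          have h2 : #S * (k - 2) + 2 * #S = k * #S := by
            rw [mul_comm 2, ← mul_add, mul_comm k]; congr 1; omega
          omega
        obtain ⟨w, hw, h1, h2⟩ := hcommon u₀ hu₀ c h.2 Sᶜ disjoint_compl_left hlarge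
        have hw' : w ∉ S := by simpa using hw
        exact (hadj h1 fun h => hw' h.2).reachable.trans (hadj h2 fun h => hw' h.2).reachable.symm
      · exact ih.trans (hadj hbc h).reachable
  have htree' : ¬ ToughKTree.HasSpanningKTree (G.removeInside S) k := fun ⟨T, hT, h⟩ =>
    htree ⟨T, hT.trans (G.removeInside_le S), h⟩
  obtain ⟨S', hS'ne, hS'c, hS'i⟩ := exists_finset_of_not_hasSpanningKTree hG'conn htree'
  by_cases hsub : S ⊆ S'
  · have heq : ToughKTree.deleteVertices (G.removeInside S) S' =
        ToughKTree.deleteVertices G S' := by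
      ext a b
      refine ⟨fun h => h.1, fun h => ⟨h, fun h' => ?_⟩⟩
      exact a.2 (mem_coe.2 (hsub h'.1))
    rw [heq] at hS'c hS'i
    have hSS' : S = S' := Finset.eq_of_subset_of_card_le hsub (hSmax' S' ⟨hS'ne, hS'c⟩)
    subst hSS'
    have hlast := hS'i fun u hu v hv h => h.2 ⟨hu, hv⟩
    have h1 := Nat.mul_le_mul_left t hlast
    have h2 : #S ≤ t * #S := Nat.le_mul_of_pos_left _ ht
    nlinarith
  · obtain ⟨u, huS, huS'⟩ := Finset.not_subset.1 hsub
    have hS'n := numComponents_deleteVertices_add_card_le (G.removeInside S) S'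
    set H := ToughKTree.deleteVertices (G.removeInside S) S' with hH
    have hu' : u ∈ ((S' : Set V)ᶜ : Set V) := fun h => huS' (mem_coe.1 h)
    have hlarge : 2 * N < #(Sᶜ \ S') := by
      have h1 := Finset.le_card_sdiff S' Sᶜ
      rw [Finset.card_compl] at h1
      by_contra hle
      have h2 : Fintype.card V ≤ 2 * N + #S + #S' := by omega
      have h3 : k * #S + 3 ≤ #S + Fintype.card V := by omega
      have h4 : k * #S' + 3 ≤ #S' + Fintype.card V := by omega
      obtain ⟨j, rfl⟩ : ∃ j, k = j + 1 := ⟨k - 1, by omega⟩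
      have h5 := Nat.mul_le_mul_left j h2
      nlinarith
    have hsame : ∀ v (hv : v ∈ ((S' : Set V)ᶜ : Set V)), v ∈ S → H.Reachable ⟨u, hu'⟩ ⟨v, hv⟩ := by
      intro v hv hvS
      obtain ⟨w, hw, h1, h2⟩ := hcommon u huS v hvS (Sᶜ \ S')
        (Finset.disjoint_of_subset_left Finset.sdiff_subset disjoint_compl_left) hlarge
      rw [mem_sdiff, mem_compl] at hw
      have hw' : w ∈ ((S' : Set V)ᶜ : Set V) := fun h => hw.2 (mem_coe.1 h)
      have e1 : H.Adj ⟨u, hu'⟩ ⟨w, hw'⟩ := hadj h1 fun h => hw.1 h.2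
      have e2 : H.Adj ⟨v, hv⟩ ⟨w, hw'⟩ := hadj h2 fun h => hw.1 h.2
      exact e1.reachable.trans e2.reachable.symm
    -- every component of `H` without `u` has a vertex outside `S` that is not adjacent to `u`
    have hrep : ∀ c : H.ConnectedComponent, ∃ v, H.connectedComponentMk v = c :=
      fun c => c.exists_rep
    choose r hr using hrep
    have hcount : #(univ.erase (H.connectedComponentMk ⟨u, hu'⟩)) ≤ #{v | v ∉ S ∧ ¬ G.Adj u v} := by
      refine Finset.card_le_card_of_injOn (fun c => (r c : V)) ?_ ?_
      · intro c hc
        have hc' : c ≠ H.connectedComponentMk ⟨u, hu'⟩ := by simpa using hc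
        have hnS : (r c : V) ∉ S := fun h => hc' (by
          rw [← hr c]
          exact (ConnectedComponent.sound (hsame _ (r c).2 h)).symm)
        have hna : ¬ G.Adj u (r c) := fun h => hc' (by
          rw [← hr c]
          have : H.Adj ⟨u, hu'⟩ (r c) := hadj h fun h => hnS h.2
          exact (ConnectedComponent.sound this.reachable).symm)
        simpa using ⟨hnS, hna⟩
      · intro c _ d _ h
        rw [← hr c, ← hr d, Subtype.ext h]
    rw [Finset.card_erase_of_mem (mem_univ _), Finset.card_univ, ← Nat.card_eq_fintype_card]
      at hcount
    change ToughKTree.numComponents H - 1 ≤ _ at hcount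
    have h1 := hcon u huS
    have h2 : 1 ≤ #S' := hS'ne.card_pos
    obtain ⟨j, rfl⟩ : ∃ j, k = j + 2 := ⟨k - 2, by omega⟩
    have h3 : j ≤ j * #S' := Nat.le_mul_of_pos_right _ h2
    have h4 : (j + 2) * #S' = j * #S' + 2 * #S' := by ring
    omega

end SimpleGraph

/-! ### Supersolutions of the signless Laplacian -/

namespace SimpleGraph

variable {V : Type*}

open Classical in
theorem signlessLaplacian_mulVec [Fintype V] (G : SimpleGraph V) (f : V → ℝ) (v : V) :
    (ToughKTree.signlessLaplacian G).mulVec f v = ∑ x with G.Adj v x, (f v + f x) := by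
  rw [ToughKTree.signlessLaplacian, Matrix.add_mulVec, Pi.add_apply, degMatrix_mulVec_apply,
    adjMatrix_mulVec_apply, Finset.sum_add_distrib, Finset.sum_const, nsmul_eq_mul,
    ← card_neighborFinset_eq_degree, neighborFinset_eq_filter]

open Classical in
theorem mem_spectrum_signlessLaplacian_iff [Fintype V] (G : SimpleGraph V) (μ : ℝ) :
    μ ∈ spectrum ℝ (ToughKTree.signlessLaplacian G) ↔
      ∃ f : V → ℝ, f ≠ 0 ∧ ∀ v, ∑ x with G.Adj v x, (f v + f x) = μ * f v := by
  rw [← Matrix.spectrum_toLin', ← Module.End.hasEigenvalue_iff_mem_spectrum]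
  constructor
  · intro h
    obtain ⟨f, hf⟩ := h.exists_hasEigenvector
    refine ⟨f, hf.2, fun v => ?_⟩
    have := congrFun hf.apply_eq_smul v
    rw [Matrix.toLin'_apply, signlessLaplacian_mulVec] at this
    simpa using this
  · rintro ⟨f, hf, h⟩
    refine Module.End.hasEigenvalue_of_hasEigenvector (x := f) ⟨?_, hf⟩
    rw [Module.End.mem_eigenspace_iff, Matrix.toLin'_apply]
    ext v
    rw [signlessLaplacian_mulVec, h v]
    simp

open Classical in
theorem le_signlessRadius [Fintype V] (G : SimpleGraph V) {μ : ℝ} {f : V → ℝ} (hf : f ≠ 0)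
    (h : ∀ v, ∑ x with G.Adj v x, (f v + f x) = μ * f v) : μ ≤ ToughKTree.signlessRadius G :=
  le_csSup (Matrix.finite_spectrum _).bddAbove
    ((G.mem_spectrum_signlessLaplacian_iff μ).2 ⟨f, hf, h⟩)

open Classical in
/-- A positive strict supersolution bounds the largest eigenvalue. -/
theorem signlessRadius_lt [Fintype V] (G : SimpleGraph V) {μ : ℝ} (hμ : 0 < μ) {w : V → ℝ}
    (hw : ∀ v, 0 < w v) (h : ∀ v, ∑ x with G.Adj v x, (w v + w x) < μ * w v) :
    ToughKTree.signlessRadius G < μ := by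
  rcases (spectrum ℝ (ToughKTree.signlessLaplacian G)).eq_empty_or_nonempty with he | hne
  · rwa [ToughKTree.signlessRadius, he, Real.sSup_empty]
  obtain ⟨f, hf, hfq⟩ := (G.mem_spectrum_signlessLaplacian_iff _).1
    (hne.csSup_mem (Matrix.finite_spectrum _))
  change ∀ v, _ = ToughKTree.signlessRadius G * f v at hfq
  obtain ⟨v₀, hv₀⟩ := Function.ne_iff.1 hf
  -- compare at a vertex where `|f| / w` is largest
  obtain ⟨v, -, hv⟩ := Finset.exists_max_image univ (fun v => |f v| / w v) ⟨v₀, mem_univ _⟩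
  have hρ : 0 < |f v| / w v :=
    (div_pos (abs_pos.2 hv₀) (hw v₀)).trans_le (hv v₀ (mem_univ _))
  have hle : ∀ x, |f x| ≤ |f v| / w v * w x := fun x => by
    rw [← div_le_iff₀ (hw x)]; exact hv x (mem_univ _)
  have hfv : 0 < |f v| := by
    by_contra hcon
    have : |f v| = 0 := le_antisymm (not_lt.1 hcon) (abs_nonneg _)
    simp [this] at hρ
  have h1 : ToughKTree.signlessRadius G * |f v| ≤ |∑ x with G.Adj v x, (f v + f x)| := by
    rw [hfq v, abs_mul]
    exact mul_le_mul_of_nonneg_right (le_abs_self _) (abs_nonneg _)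
  have h2 : |∑ x with G.Adj v x, (f v + f x)| ≤
      |f v| / w v * ∑ x with G.Adj v x, (w v + w x) := by
    rw [Finset.mul_sum]
    refine (Finset.abs_sum_le_sum_abs _ _).trans (Finset.sum_le_sum fun x _ => ?_)
    rw [mul_add]
    exact (abs_add_le _ _).trans (add_le_add (hle v) (hle x))
  have h3 : |f v| / w v * ∑ x with G.Adj v x, (w v + w x) < |f v| / w v * (μ * w v) :=
    mul_lt_mul_of_pos_left (h v) hρ
  have h4 : |f v| / w v * (μ * w v) = μ * |f v| := by
    have := (hw v).ne'
    field_simp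
  exact lt_of_mul_lt_mul_right (h1.trans_lt (h2.trans_lt (h3.trans_eq h4))) hfv.le

theorem card_component_add_numComponents_le [Fintype V] {G : SimpleGraph V}
    (c : G.ConnectedComponent) :
    Nat.card c + ToughKTree.numComponents G ≤ Fintype.card V + 1 := by
  classical
  have h1 : Fintype.card V = ∑ c : G.ConnectedComponent, Nat.card c := by
    rw [← Finset.card_univ, Finset.card_eq_sum_card_fiberwise (f := G.connectedComponentMk)
      (t := univ) (by simp)]
    exact Finset.sum_congr rfl fun c _ => card_fiber_connectedComponentMk c
  have h2 : #(univ.erase c) ≤ ∑ d ∈ univ.erase c, Nat.card d := by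
    rw [Finset.card_eq_sum_ones]
    refine Finset.sum_le_sum fun d _ => ?_
    have : Nonempty d := d.nonempty_supp.to_subtype
    exact Nat.card_pos
  rw [h1, ← Finset.add_sum_erase _ _ (mem_univ c)]
  rw [Finset.card_erase_of_mem (mem_univ _), Finset.card_univ, ← Nat.card_eq_fintype_card] at h2
  change ToughKTree.numComponents G - 1 ≤ _ at h2
  omega

theorem sum_inv_card_component [Fintype V] (G : SimpleGraph V) :
    ∑ v, (1 : ℝ) / Nat.card (G.connectedComponentMk v) = ToughKTree.numComponents G := by
  classical
  rw [← Finset.sum_fiberwise Finset.univ G.connectedComponentMk]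
  have : ∀ c : G.ConnectedComponent, ∑ v with G.connectedComponentMk v = c,
      (1 : ℝ) / Nat.card (G.connectedComponentMk v) = 1 := by
    intro c
    have hpos : (Nat.card c : ℝ) ≠ 0 := by
      have : Nonempty c := c.nonempty_supp.to_subtype
      exact_mod_cast Nat.card_pos.ne'
    rw [Finset.sum_congr rfl (g := fun _ => (1 : ℝ) / Nat.card c), Finset.sum_const,
      card_fiber_connectedComponentMk, nsmul_eq_mul]
    · field_simp
    · intro v hv
      rw [(mem_filter_univ v).1 hv]
  rw [Finset.sum_congr rfl fun c _ => this c, Finset.sum_const, nsmul_eq_mul, mul_one,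
    Finset.card_univ, ← Nat.card_eq_fintype_card]
  rfl

theorem ncard_neighborSet_lt_card_component [Finite V] (G : SimpleGraph V) (v : V) :
    (G.neighborSet v).ncard < Nat.card (G.connectedComponentMk v) := by
  have hsub : G.neighborSet v ⊂ (G.connectedComponentMk v).supp := by
    refine ⟨fun x hx => ?_, fun h => ?_⟩
    · exact ConnectedComponent.sound (Adj.reachable hx).symm
    · exact G.loopless.irrefl v (h rfl)
  exact Set.ncard_lt_ncard hsub (Set.toFinite _)

/-- The convexity behind the extremal distribution of component sizes: the total weight of the
components is largest if all of them but one are single vertices. -/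
theorem sum_weight_components_le [Fintype V] (G : SimpleGraph V) {m a : ℕ} {σ C : ℝ}
    (hσ : 0 < σ) (hm : 1 ≤ m) (hC : 2 * (m : ℝ) < C) (hcard : Fintype.card V = m + a)
    (hc : a + 1 ≤ ToughKTree.numComponents G) :
    ∑ v, σ / (C - 2 * Nat.card (G.connectedComponentMk v)) ≤
      m * (σ / (C - 2 * m)) + a * (σ / (C - 2)) := by
  have hm' : (1 : ℝ) ≤ m := by exact_mod_cast hm
  have hC2 : 0 < C - 2 := by linarith
  have hCm : 0 < C - 2 * m := by linarith
  set K := C * σ / ((C - 2) * (C - 2 * m)) with hK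
  set φ := σ / (C - 2) with hφ
  have hKφ : φ ≤ K := by
    rw [hK, hφ, div_le_div_iff₀ hC2 (mul_pos hC2 hCm)]
    have : 0 ≤ σ * (C - 2) * (2 * m) := by positivity
    nlinarith
  have hterm : ∀ v, σ / (C - 2 * Nat.card (G.connectedComponentMk v)) ≤
      K - (K - φ) * (1 / Nat.card (G.connectedComponentMk v)) := by
    intro v
    set x := Nat.card (G.connectedComponentMk v) with hx
    have hx1 : (1 : ℝ) ≤ x := by
      have : Nonempty (G.connectedComponentMk v) :=
        (G.connectedComponentMk v).nonempty_supp.to_subtype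
      exact_mod_cast Nat.card_pos
    have hxm : (x : ℝ) ≤ m := by
      have := card_component_add_numComponents_le (G.connectedComponentMk v)
      have : x ≤ m := by omega
      exact_mod_cast this
    have hCx : 0 < C - 2 * x := by linarith
    have h0 : (0 : ℝ) < x := by linarith
    have hKx : C * σ / ((C - 2) * (C - 2 * x)) ≤ K := by
      rw [hK]
      have : 0 ≤ C * σ := mul_nonneg (by linarith) hσ.le
      gcongr
    have e1 : σ / (C - 2 * x) = (φ + (x - 1) * (C * σ / ((C - 2) * (C - 2 * x)))) / x := by
      rw [hφ]
      field_simp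
      ring
    have e2 : K - (K - φ) * (1 / x) = (φ + (x - 1) * K) / x := by
      field_simp
      ring
    rw [e1, e2]
    have : (0 : ℝ) ≤ x - 1 := by linarith
    gcongr
  refine (Finset.sum_le_sum fun v _ => hterm v).trans ?_
  rw [Finset.sum_sub_distrib, ← Finset.mul_sum, sum_inv_card_component, Finset.sum_const,
    Finset.card_univ, hcard, nsmul_eq_mul]
  have hc' : (a : ℝ) + 1 ≤ ToughKTree.numComponents G := by exact_mod_cast hc
  have h1 := mul_le_mul_of_nonneg_left hc' (sub_nonneg.2 hKφ)
  have h2 : (m : ℝ) * (σ / (C - 2 * m)) = φ + (m - 1) * K := by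
    rw [hφ, hK, ← mul_div_assoc, ← mul_div_assoc, div_add_div _ _ hC2.ne' (mul_pos hC2 hCm).ne',
      div_eq_div_iff hCm.ne' (mul_pos hC2 (mul_pos hC2 hCm)).ne']
    ring
  push_cast
  linarith

open Classical in
/-- A bound for the largest eigenvalue of a graph `G` in which the deletion of `S` leaves more than
`a` components and in which the vertex `u` of `S` has `M` non-neighbours outside `S`. The
supersolution has the value `ξ` at `u`, the value `1` on the rest of `S`, and a value depending only
on the size of the component elsewhere. -/
theorem signlessRadius_lt_of_components [Fintype V] (G : SimpleGraph V)
    {S : Finset V} {u : V} (hu : u ∈ S) {m a M : ℕ} {ξ σ μ : ℝ} (hm : 1 ≤ m)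
    (hcard : Fintype.card V = #S + m + a)
    (hc : a + 1 ≤ ToughKTree.numComponents (ToughKTree.deleteVertices G S))
    (hM : M ≤ #{v | v ∉ S ∧ ¬ G.Adj u v}) (hξ : 0 < ξ) (hσ : #S - 1 + ξ < σ)
    (hμ : 0 < μ - #S - 2 * m + 2)
    (h1 : #S + m + a + #S - 3 + ξ + (m * (σ / (μ - #S - 2 * m + 2)) + a * (σ / (μ - #S))) < μ)
    (h2 : (#S + m + a - 1 - M) * ξ + (#S - 1) +
      (m * (σ / (μ - #S - 2 * m + 2)) + a * (σ / (μ - #S))) < μ * ξ) :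
    ToughKTree.signlessRadius G < μ := by
  set s : ℝ := (#S : ℝ) with hs
  have hm' : (1 : ℝ) ≤ m := by exact_mod_cast hm
  have hs1 : (1 : ℝ) ≤ s := by
    rw [hs]; exact_mod_cast Finset.card_pos.2 ⟨u, hu⟩
  have hσ0 : 0 < σ := by linarith
  set H := ToughKTree.deleteVertices G S with hH
  set φ : ((S : Set V)ᶜ : Set V) → ℝ :=
    fun v => σ / ((μ - s + 2) - 2 * Nat.card (H.connectedComponentMk v)) with hφ
  have hcardW : Fintype.card ((S : Set V)ᶜ : Set V) = m + a := by
    rw [Fintype.card_compl_set]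
    simp
    omega
  have hsize : ∀ v, (Nat.card (H.connectedComponentMk v) : ℝ) ≤ m := by
    intro v
    have := card_component_add_numComponents_le (H.connectedComponentMk v)
    rw [hcardW] at this
    have : Nat.card (H.connectedComponentMk v) ≤ m := by omega
    exact_mod_cast this
  have hφpos : ∀ v, 0 < φ v := fun v => div_pos hσ0 (by have := hsize v; linarith)
  have hphi : ∑ v, φ v ≤ m * (σ / (μ - s - 2 * m + 2)) + a * (σ / (μ - s)) := by
    have := sum_weight_components_le H (m := m) (a := a) (σ := σ) (C := μ - s + 2) hσ0 hm
      (by linarith) hcardW hc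
    rwa [show μ - s + 2 - 2 * m = μ - s - 2 * m + 2 by ring,
      show μ - s + 2 - 2 = μ - s by ring] at this
  set T := m * (σ / (μ - s - 2 * m + 2)) + a * (σ / (μ - s)) with hT
  set w : V → ℝ := fun v => if h : v ∈ S then (if v = u then ξ else 1) else
    φ ⟨v, fun h' => h (mem_coe.1 h')⟩ with hw
  have hwu : w u = ξ := by simp [hw, hu]
  have hwS : ∀ v ∈ S, v ≠ u → w v = 1 := fun v hv hvu => by simp [hw, hv, hvu]
  have hwo : ∀ v (h : v ∉ S), w v = φ ⟨v, fun h' => h (mem_coe.1 h')⟩ := fun v h => by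
    simp [hw, h]
  have hwpos : ∀ v, 0 < w v := by
    intro v
    by_cases hv : v ∈ S
    · by_cases hvu : v = u
      · rw [hvu, hwu]; exact hξ
      · rw [hwS v hv hvu]; exact one_pos
    · rw [hwo v hv]; exact hφpos _
  have hsumS : ∑ x ∈ S, w x = s - 1 + ξ := by
    rw [← Finset.add_sum_erase _ _ hu, hwu, Finset.sum_congr rfl (g := fun _ => (1 : ℝ)),
      Finset.sum_const, Finset.card_erase_of_mem hu, nsmul_eq_mul, Nat.cast_sub]
    · push_cast; ring
    · exact Finset.card_pos.2 ⟨u, hu⟩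
    · intro x hx
      exact hwS x (Finset.mem_of_mem_erase hx) (Finset.ne_of_mem_erase hx)
  have hsumo : ∑ x ∈ Sᶜ, w x = ∑ v, φ v := by
    rw [Finset.sum_subtype Sᶜ (p := fun x => x ∈ ((S : Set V)ᶜ : Set V)) (fun x => by simp)]
    refine Finset.sum_congr rfl fun v _ => ?_
    rw [hwo v.1 (fun h => v.2 (mem_coe.2 h))]
  have hsum : ∑ x, w x ≤ s - 1 + ξ + T := by
    rw [← Finset.sum_add_sum_compl S, hsumS, hsumo]
    linarith
  have hμ0 : 0 < μ := by linarith
  refine G.signlessRadius_lt hμ0 hwpos fun v => ?_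
  have hn : (Fintype.card V : ℝ) = s + m + a := by rw [hcard]; push_cast; rfl
  by_cases hv : v ∈ S
  · by_cases hvu : v = u
    · subst hvu
      have hdeg : (#{x | G.Adj v x} : ℝ) ≤ s + m + a - 1 - M := by
        have hdisj : Disjoint ({x | G.Adj v x} : Finset V)
            (insert v ({x | x ∉ S ∧ ¬ G.Adj v x} : Finset V)) := by
          rw [Finset.disjoint_left]
          intro x hx hx'
          rw [mem_filter_univ] at hx
          rw [mem_insert, mem_filter_univ] at hx'
          rcases hx' with rfl | hx'
          · exact hx.ne rfl
          · exact hx'.2 hx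
        have hcu := Finset.card_le_univ (({x | G.Adj v x} : Finset V) ∪
            (insert v ({x | x ∉ S ∧ ¬ G.Adj v x} : Finset V)))
        rw [Finset.card_union_of_disjoint hdisj, Finset.card_insert_of_notMem (by simp [hu])] at hcu
        have hcu' : #{x | G.Adj v x} + (M + 1) ≤ Fintype.card V := by omega
        have : (#{x | G.Adj v x} : ℝ) + (M + 1) ≤ Fintype.card V := by exact_mod_cast hcu'
        linarith
      have hrest : ∑ x with G.Adj v x, w x ≤ s - 1 + T := by
        have hsub : ({x | G.Adj v x} : Finset V) ⊆ univ.erase v := by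
          intro x hx
          rw [mem_filter_univ] at hx
          exact Finset.mem_erase.2 ⟨hx.ne', mem_univ _⟩
        have h3 := Finset.sum_le_sum_of_subset_of_nonneg hsub (f := w)
          (fun x _ _ => (hwpos x).le)
        have h4 := Finset.add_sum_erase univ w (mem_univ v)
        rw [hwu] at h4
        linarith
      rw [Finset.sum_add_distrib, Finset.sum_const, nsmul_eq_mul, hwu]
      have := mul_le_mul_of_nonneg_right hdeg hξ.le
      linarith
    · have hsub : ({x | G.Adj v x} : Finset V) ⊆ univ.erase v := by
        intro x hx
        rw [mem_filter_univ] at hx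
        exact Finset.mem_erase.2 ⟨hx.ne', mem_univ _⟩
      have h3 := Finset.sum_le_sum_of_subset_of_nonneg hsub (f := fun x => w v + w x)
        (fun x _ _ => (add_pos (hwpos v) (hwpos x)).le)
      have h4 := Finset.add_sum_erase univ (fun x => w v + w x) (mem_univ v)
      rw [Finset.sum_add_distrib (s := univ), Finset.sum_const, Finset.card_univ, nsmul_eq_mul,
        hn] at h4
      have h5 := hwS v hv hvu
      simp only [h5] at h3 h4 ⊢
      linarith
  · set W : ((S : Set V)ᶜ : Set V) := ⟨v, fun h' => hv (mem_coe.1 h')⟩ with hW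
    have hwv : w v = φ W := hwo v hv
    rw [← Finset.sum_filter_add_sum_filter_not _ (fun x => x ∈ S)]
    have hin : ∑ x ∈ {x | G.Adj v x} with x ∈ S, (w v + w x) ≤ s * w v + (s - 1 + ξ) := by
      refine (Finset.sum_le_sum_of_subset_of_nonneg (t := S) (fun x hx => (mem_filter.1 hx).2)
        (fun x _ _ => (add_pos (hwpos v) (hwpos x)).le)).trans ?_
      rw [Finset.sum_add_distrib, hsumS, Finset.sum_const, nsmul_eq_mul]
    have hout : ∑ x ∈ {x | G.Adj v x} with x ∉ S, (w v + w x) ≤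
        (Nat.card (H.connectedComponentMk W) - 1) * (2 * w v) := by
      rw [Finset.sum_congr rfl (g := fun _ => 2 * w v), Finset.sum_const, nsmul_eq_mul]
      · refine mul_le_mul_of_nonneg_right ?_ (by have := hwpos v; linarith)
        have h3 : #{x ∈ ({x | G.Adj v x} : Finset V) | x ∉ S} ≤ (H.neighborSet W).ncard := by
          rw [← Set.ncard_image_of_injective _ Subtype.val_injective, ← Set.ncard_coe_finset]
          refine Set.ncard_le_ncard (fun x hx => ?_) (Set.toFinite _)
          rw [mem_coe, mem_filter, mem_filter_univ] at hx
          exact ⟨⟨x, fun h' => hx.2 (mem_coe.1 h')⟩, hx.1, rfl⟩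
        have h4 := H.ncard_neighborSet_lt_card_component W
        have h5 : #{x ∈ ({x | G.Adj v x} : Finset V) | x ∉ S} + 1 ≤
          Nat.card (H.connectedComponentMk W) := by omega
        have h6 : (#{x ∈ ({x | G.Adj v x} : Finset V) | x ∉ S} : ℝ) + 1 ≤
          Nat.card (H.connectedComponentMk W) := by exact_mod_cast h5
        linarith
      · intro x hx
        rw [mem_filter, mem_filter_univ] at hx
        have hadj : H.Adj W ⟨x, fun h' => hx.2 (mem_coe.1 h')⟩ := hx.1
        have : w x = w v := by
          rw [hwv, hwo x hx.2, hφ]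
          simp only
          rw [ConnectedComponent.sound hadj.reachable]
        rw [this]; ring
    have hsz := hsize W
    have hden : 0 < (μ - s + 2) - 2 * Nat.card (H.connectedComponentMk W) := by linarith
    have heq : w v * ((μ - s + 2) - 2 * Nat.card (H.connectedComponentMk W)) = σ := by
      rw [hwv, hφ]
      exact div_mul_cancel₀ _ hden.ne'
    linarith

end SimpleGraph

/-! ### The largest eigenvalue of the extremal graph -/

namespace SimpleGraph

/-- The largest eigenvalue of `K_s ∨ (K_m ∪ a K_1)` is at least the eigenvalue `μ` of an eigenvector
with the values `1`, `y` and `z` on the three parts. -/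
theorem le_signlessRadius_join {s m a : ℕ} {y z μ : ℝ} (hs : 1 ≤ s)
    (h1 : 2 * ((s : ℝ) - 1) + m * (1 + y) + a * (1 + z) = μ)
    (h2 : s * (y + 1) + (m - 1) * (2 * y) = μ * y) (h3 : s * (z + 1) = μ * z) :
    μ ≤ ToughKTree.signlessRadius (ToughKTree.join (⊤ : SimpleGraph (Fin s))
      (SimpleGraph.sum (⊤ : SimpleGraph (Fin m)) (⊥ : SimpleGraph (Fin a)))) := by
  classical
  refine le_signlessRadius _ (f := Sum.elim (fun _ => 1) (Sum.elim (fun _ => y) fun _ => z)) ?_ ?_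
  · intro h
    have := congrFun h (Sum.inl ⟨0, hs⟩)
    simp at this
  · have htop : ∀ (N : ℕ) (i : Fin N) (c : ℝ),
        ∑ x : Fin N, (if i ≠ x then c else 0) = (N - 1) * c := by
      intro N i c
      rw [← Finset.sum_filter, Finset.sum_const, Finset.filter_ne, Finset.card_erase_of_mem
        (mem_univ _), Finset.card_univ, Fintype.card_fin, nsmul_eq_mul, Nat.cast_sub]
      · simp
      · exact Fin.pos i
    intro v
    rw [Finset.sum_filter, Fintype.sum_sum_type, Fintype.sum_sum_type]
    rcases v with i | i | i
    · have := htop s i (1 + 1)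
      simp [ToughKTree.join] at this ⊢
      rw [this]
      linarith
    · have := htop m i (y + y)
      simp [ToughKTree.join] at this ⊢
      rw [this]
      linarith
    · simp [ToughKTree.join]
      linarith

/-- The equation that determines the largest eigenvalue `2m + 2s - 2 + g` of `K_s ∨ (K_m ∪ a K_1)`
has a solution. -/
theorem exists_root {s m a : ℝ} (hs : 0 < s) (hm : 1 ≤ m) (ha : 0 < a) :
    ∃ g, 0 < g ∧ a * s / (2 * m + s - 2 + g) + a = m * g / (s + g) + g := by
  have hcont : ContinuousOn (fun g => m * g / (s + g) + g - (a * s / (2 * m + s - 2 + g) + a))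
      (Set.Icc 0 (2 * a)) := by
    refine ContinuousOn.sub (ContinuousOn.add (ContinuousOn.div ?_ ?_ ?_) ?_)
      (ContinuousOn.add (ContinuousOn.div ?_ ?_ ?_) ?_) <;> try fun_prop
    · intro g hg
      have := hg.1
      positivity
    · intro g hg
      have := hg.1
      have : 0 < 2 * m + s - 2 + g := by linarith
      exact this.ne'
  have hivt := intermediate_value_Icc (by linarith : (0 : ℝ) ≤ 2 * a) hcont
  have h0 : (0 : ℝ) ∈ Set.Icc
      ((fun g => m * g / (s + g) + g - (a * s / (2 * m + s - 2 + g) + a)) 0)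
      ((fun g => m * g / (s + g) + g - (a * s / (2 * m + s - 2 + g) + a)) (2 * a)) := by
    constructor
    · have h : 0 ≤ a * s / (2 * m + s - 2 + 0) := div_nonneg (by positivity) (by linarith)
      simp only [mul_zero, zero_div]
      linarith
    · have h : a * s / (2 * m + s - 2 + 2 * a) ≤ a := by
        rw [div_le_iff₀ (by linarith)]
        exact mul_le_mul_of_nonneg_left (by linarith) ha.le
      have h' : 0 ≤ m * (2 * a) / (s + 2 * a) := by positivity
      simp only
      linarith
  obtain ⟨g, hg, hg0⟩ := hivt h0
  simp only at hg0
  refine ⟨g, lt_of_le_of_ne hg.1 ?_, by linarith⟩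
  rintro rfl
  have h : 0 ≤ a * s / (2 * m + s - 2 + 0) := div_nonneg (by positivity) (by linarith)
  simp only [mul_zero, zero_div] at hg0
  linarith

theorem le_signlessRadius_join_of_root {s m a : ℕ} {g : ℝ} (hs : 1 ≤ s) (hm : 1 ≤ m)
    (hg : 0 < g) (h : (a : ℝ) * s / (2 * m + s - 2 + g) + a = m * g / (s + g) + g) :
    2 * (m : ℝ) + 2 * s - 2 + g ≤
      ToughKTree.signlessRadius (ToughKTree.join (⊤ : SimpleGraph (Fin s))
        (SimpleGraph.sum (⊤ : SimpleGraph (Fin m)) (⊥ : SimpleGraph (Fin a)))) := by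
  have hs' : (1 : ℝ) ≤ s := by exact_mod_cast hs
  have hm' : (1 : ℝ) ≤ m := by exact_mod_cast hm
  have hA : (s : ℝ) + g ≠ 0 := by positivity
  have hL : 2 * (m : ℝ) + s - 2 + g ≠ 0 := by
    have : 0 < 2 * (m : ℝ) + s - 2 + g := by linarith
    exact this.ne'
  refine le_signlessRadius_join (y := s / (s + g)) (z := s / (2 * m + s - 2 + g)) hs ?_ ?_ ?_
  · have e1 : (m : ℝ) * (s / (s + g)) = m - m * g / (s + g) := by
      field_simp
      ring
    have e2 : (a : ℝ) * (s / (2 * m + s - 2 + g)) = a * s / (2 * m + s - 2 + g) := by ring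
    rw [mul_add, mul_add, e1, e2]
    linarith
  · field_simp
    ring
  · field_simp
    ring

open Classical in
/-- A single non-neighbour suffices to make the bound strict. -/
theorem signlessRadius_lt_of_nonneighbor {V : Type*} [Fintype V] (G : SimpleGraph V)
    {S : Finset V} {u : V} (hu : u ∈ S) {m a : ℕ} {μ : ℝ} (hm : 1 ≤ m)
    (hcard : Fintype.card V = #S + m + a)
    (hc : a + 1 ≤ ToughKTree.numComponents (ToughKTree.deleteVertices G S))
    (hM : 1 ≤ #{v | v ∉ S ∧ ¬ G.Adj u v}) (hμ : 0 < μ - #S - 2 * m + 2)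
    (h : #S + m + a + #S - 2 + (m * (#S / (μ - #S - 2 * m + 2)) + a * (#S / (μ - #S))) ≤ μ) :
    ToughKTree.signlessRadius G < μ := by
  have hm' : (1 : ℝ) ≤ m := by exact_mod_cast hm
  have hs1 : (1 : ℝ) ≤ #S := by exact_mod_cast Finset.card_pos.2 ⟨u, hu⟩
  have hμs : 0 < μ - #S := by linarith
  have hT : 0 < m * (#S / (μ - #S - 2 * m + 2)) + a * (#S / (μ - #S)) := by positivity
  set T := m * (#S / (μ - #S - 2 * m + 2)) + a * (#S / (μ - #S)) with hTdef
  set D := μ - (#S + m + a) + 2 with hD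
  have hD1 : 1 < D := by linarith
  have hξ : (D - 1 / 2) / D < 1 := by rw [div_lt_one (by linarith)]; linarith
  have hξD : (D - 1 / 2) / D * D = D - 1 / 2 := div_mul_cancel₀ _ (by linarith)
  refine G.signlessRadius_lt_of_components hu (ξ := (D - 1 / 2) / D) (σ := #S) hm hcard hc hM
    (div_pos (by linarith) (by linarith)) (by linarith) hμ (by linarith) ?_
  push_cast
  rw [← hTdef]
  generalize (D - 1 / 2) / D = ξ at hξ hξD
  rw [hD] at hξD
  linarith

end SimpleGraph

/-! ### Estimates for one non-neighbour -/

namespace ToughKTree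

/-- With `p = k - 1`, `s₀ = 3t`, `m₀` and `a₀` the parameters of the extremal graph and
`μ = 2m₀ + 2s₀ - 2 + g` its largest eigenvalue, the supersolution for `s₀ + d` in place of `s₀` is
reduced to a bound on `g`. -/
theorem supersolution_of_bound {p s₀ m d g a₀ m₀ L : ℝ} (hs : 1 ≤ s₀) (hm : 1 ≤ m) (hd : 0 ≤ d)
    (hp : 1 ≤ p) (hg : 0 < g) (ha : a₀ = (p - 1) * s₀ + 2) (hm₀ : m₀ = m + p * d)
    (hLd : 0 < L - d) (hroot : a₀ * s₀ / L + a₀ = m₀ * g / (s₀ + g) + g)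
    (hX : (1 + ((p - 1) * d + 2 * (p - 1) * s₀ + 2 + a₀ * s₀ / L) / (L - d)) * (s₀ + g) ≤ p * s₀) :
    m * ((s₀ + d) / (s₀ + d + 2 * (p - 1) * d + g)) + (a₀ + (p - 1) * d) * ((s₀ + d) / (L - d)) ≤
      m + (p - 1) * d - a₀ + g := by
  have hp' : 0 ≤ p - 1 := by linarith
  have ha0 : 0 ≤ a₀ := by rw [ha]; positivity
  have hL0 : 0 < L := by linarith
  have hsg : 0 < s₀ + g := by linarith
  set X := ((p - 1) * d + 2 * (p - 1) * s₀ + 2 + a₀ * s₀ / L) / (L - d) with hXdef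
  have hX0 : 0 ≤ X := by rw [hXdef]; positivity
  have hgle : g ≤ (p - 1) * s₀ := by
    have := mul_nonneg hX0 hsg.le
    linarith
  have e1 : (s₀ + d) / (s₀ + d + 2 * (p - 1) * d + g) ≤ s₀ / (s₀ + g) := by
    rw [div_le_div_iff₀ (by positivity) hsg]
    have := mul_le_mul_of_nonneg_left hgle hd
    have := mul_nonneg hd (mul_nonneg hp' (by linarith : (0 : ℝ) ≤ s₀))
    linarith
  have e2 : (a₀ + (p - 1) * d) * ((s₀ + d) / (L - d)) = a₀ * s₀ / L + d * X := by
    rw [hXdef, ha]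
    have := hLd.ne'
    field_simp
    ring
  have e3 : X ≤ p * (s₀ / (s₀ + g)) - 1 := by
    rw [← mul_div_assoc, le_sub_iff_add_le, le_div_iff₀ hsg]
    linarith
  have e4 : m₀ * g / (s₀ + g) = m₀ - m₀ * (s₀ / (s₀ + g)) := by
    field_simp
    ring
  have e5 := mul_le_mul_of_nonneg_left e1 (by linarith : (0 : ℝ) ≤ m)
  have e6 := mul_le_mul_of_nonneg_left e3 hd
  rw [e2]
  rw [e4] at hroot
  generalize s₀ / (s₀ + g) = Y at *
  rw [hm₀] at hroot
  linarith

theorem root_mul {s₀ g a₀ m₀ ε : ℝ} (hsg : 0 < s₀ + g)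
    (hroot : ε + a₀ = m₀ * g / (s₀ + g) + g) : m₀ * s₀ = (s₀ + g) * (m₀ + g - a₀ - ε) := by
  have e4 : m₀ * g / (s₀ + g) = m₀ - m₀ * s₀ / (s₀ + g) := by
    field_simp
    ring
  rw [e4] at hroot
  have : m₀ * s₀ / (s₀ + g) = m₀ + g - a₀ - ε := by linarith
  rw [div_eq_iff hsg.ne'] at this
  linarith

/-- The bound on `g` for `t ≥ 2`. -/
theorem bound_of_two_le {p t s₀ m₀ d g a₀ L : ℝ} (hp : 2 ≤ p) (ht : 2 ≤ t) (hs : s₀ = 3 * t)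
    (hd : 0 ≤ d) (hdm : p * d ≤ m₀) (hg : 0 < g) (ha : a₀ = (p - 1) * s₀ + 2)
    (hm₀ : 3 * p * t ^ 2 - 3 * t * p + p + 3 * t ^ 2 + 18 * t + 3 ≤ m₀)
    (hL : L = 2 * m₀ + s₀ - 2 + g) (hroot : a₀ * s₀ / L + a₀ = m₀ * g / (s₀ + g) + g) :
    (1 + ((p - 1) * d + 2 * (p - 1) * s₀ + 2 + a₀ * s₀ / L) / (L - d)) * (s₀ + g) ≤ p * s₀ := by
  obtain ⟨κ, hκ, rfl⟩ : ∃ κ : ℝ, 0 ≤ κ ∧ p = κ + 2 := ⟨p - 2, by linarith, by ring⟩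
  obtain ⟨τ, hτ, rfl⟩ : ∃ τ : ℝ, 0 ≤ τ ∧ t = τ + 2 := ⟨t - 2, by linarith, by ring⟩
  have hm0 : 0 < m₀ := by
    refine lt_of_lt_of_le ?_ hm₀
    have : 0 ≤ κ * τ := by positivity
    have : 0 ≤ κ * τ ^ 2 := by positivity
    nlinarith
  have hκ1 : 0 ≤ κ + 2 - 1 := by linarith
  have ha0 : 0 ≤ a₀ := by rw [ha, hs]; positivity
  have hdm' : d ≤ m₀ := by nlinarith
  have hLd : 0 < L - d := by linarith
  have hL0 : 0 < L := by linarith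
  have hsg : 0 < s₀ + g := by linarith
  set ε := a₀ * s₀ / L with hε
  have hε0 : 0 ≤ ε := by rw [hε, hs]; positivity
  have hε3 : ε ≤ 3 := by
    rw [hε, div_le_iff₀ hL0, hL, ha, hs]
    have : 0 ≤ κ * τ := by positivity
    have : 0 ≤ κ * τ ^ 2 := by positivity
    nlinarith
  have hmul := root_mul hsg hroot
  set X := ((κ + 2 - 1) * d + 2 * (κ + 2 - 1) * s₀ + 2 + ε) / (L - d) with hX
  have hXm : (2 * κ + 3) * (X * m₀) ≤ (κ + 1) * m₀ + (κ + 2) * (2 * (κ + 1) * s₀ + 2 + ε) := by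
    have hpD : (2 * κ + 3) * m₀ ≤ (κ + 2) * (L - d) := by
      have : 0 ≤ (κ + 2) * (s₀ - 2 + g) := mul_nonneg (by linarith) (by linarith)
      rw [hL]
      linarith
    have hXD : X * (L - d) = (κ + 1) * d + 2 * (κ + 1) * s₀ + 2 + ε := by
      rw [hX, div_mul_cancel₀ _ hLd.ne']
      ring
    have hX0 : 0 ≤ X := by
      rw [hX]
      have : 0 ≤ s₀ := by linarith
      positivity
    have h1 := mul_le_mul_of_nonneg_left hpD hX0
    have h2 : X * ((κ + 2) * (L - d)) = (κ + 2) * (X * (L - d)) := by ring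
    rw [h2, hXD] at h1
    have h3 := mul_le_mul_of_nonneg_left hdm (by linarith : (0 : ℝ) ≤ κ + 1)
    linarith
  -- the factor `s₀ + g` of `root_mul` is cancelled, and `g > 0` is dropped
  have hmain : (1 + X) * m₀ ≤ (κ + 2) * (m₀ - a₀ - ε) := by
    have h1 : (2 * κ + 3) * ((1 + X) * m₀) ≤ (2 * κ + 3) * ((κ + 2) * (m₀ - a₀ - ε)) := by
      have h2 : (κ + 2) * ((2 * κ + 3) * (a₀ + 3) + (2 * (κ + 1) * s₀ + 5)) ≤
          2 * (κ + 1) ^ 2 * m₀ := by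
        refine le_trans ?_ (mul_le_mul_of_nonneg_left hm₀ (by positivity))
        rw [ha, hs]
        rw [← sub_nonneg]
        ring_nf
        positivity
      have h3 : (κ + 2) * ((2 * κ + 4) * ε) ≤ (κ + 2) * ((2 * κ + 4) * 3) := by gcongr
      linarith
    exact le_of_mul_le_mul_left h1 (by linarith)
  have h1 : ((1 + X) * (s₀ + g)) * m₀ ≤ ((κ + 2) * s₀) * m₀ := by
    have h2 := mul_le_mul_of_nonneg_left hmain hsg.le
    have h3 : 0 ≤ (s₀ + g) * ((κ + 2) * g) := by positivity
    have h4 : (κ + 2) * (m₀ * s₀) = (κ + 2) * ((s₀ + g) * (m₀ + g - a₀ - ε)) := by rw [hmul]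
    linarith
  exact le_of_mul_le_mul_right h1 hm0

/-- The bound on `g` for `t = 1`, given an upper bound `B` for the quotient in it. -/
theorem bound_of_eq_one {p m₀ d g L B : ℝ} (hp : 0 < p) (hm0 : 0 < m₀) (hg : 0 < g) (hB : 0 ≤ B)
    (hLd : 0 < L - d)
    (hroot : (3 * p - 1) * 3 / L + (3 * p - 1) = m₀ * g / (3 + g) + g)
    (hXB : (p - 1) * d + 6 * (p - 1) + 2 + (3 * p - 1) * 3 / L ≤ B * (L - d))
    (hmain : (1 + B) * (p * (3 * p + 2 + (3 * p - 1) * 3 / L) + (1 + B) * m₀) ≤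
      (1 + B) * (p * m₀) + 3 * p ^ 2) :
    (1 + ((p - 1) * d + 6 * (p - 1) + 2 + (3 * p - 1) * 3 / L) / (L - d)) * (3 + g) ≤ p * 3 := by
  have hmul := root_mul (by linarith) hroot
  set ε := (3 * p - 1) * 3 / L
  have hX : ((p - 1) * d + 6 * (p - 1) + 2 + ε) / (L - d) ≤ B := by rwa [div_le_iff₀ hLd]
  set X := ((p - 1) * d + 6 * (p - 1) + 2 + ε) / (L - d)
  have h3g : 0 < 3 + g := by linarith
  by_contra hcon
  rw [not_le] at hcon
  have h1 : p * 3 < (1 + B) * (3 + g) := hcon.trans_le (by gcongr)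
  -- by `root_mul`, smallness of `p` against `3 + g` is smallness of `m₀`
  have h2 : p * (m₀ + g - (3 * p - 1) - ε) < (1 + B) * m₀ := by
    have h3 : (3 + g) * (p * (m₀ + g - (3 * p - 1) - ε)) < (3 + g) * ((1 + B) * m₀) := by
      have h4 := mul_lt_mul_of_pos_right h1 hm0
      have h5 : p * (m₀ * 3) = p * ((3 + g) * (m₀ + g - (3 * p - 1) - ε)) := by rw [hmul]
      linarith
    exact lt_of_mul_lt_mul_left h3 h3g.le
  have h3 := mul_lt_mul_of_pos_left h2 (by linarith : (0 : ℝ) < 1 + B)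
  have h4 := mul_lt_mul_of_pos_left h1 hp
  linarith

/-- The bound on `g` for `t = 1` and `k = p + 1 ≤ 14`. -/
theorem bound_of_eq_one_of_le {p : ℕ} {m₀ d g L : ℝ} (hp : 2 ≤ p) (hp' : p ≤ 13) (hd : 0 ≤ d)
    (hm₀ : (p : ℝ) + 24 ≤ m₀) (hdm : p * d + 1 ≤ m₀) (hg : 0 < g) (hL : L = 2 * m₀ + 3 - 2 + g)
    (hroot : (3 * (p : ℝ) - 1) * 3 / L + (3 * p - 1) = m₀ * g / (3 + g) + g) :
    (1 + (((p : ℝ) - 1) * d + 6 * (p - 1) + 2 + (3 * p - 1) * 3 / L) / (L - d)) * (3 + g) ≤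
      p * 3 := by
  have hp2 : (2 : ℝ) ≤ p := by exact_mod_cast hp
  have hdm' : d ≤ m₀ := by nlinarith
  have hε : (3 * (p : ℝ) - 1) * 3 / L ≤ (3 * p - 1) * 3 / (2 * p + 49) := by
    have : 0 < 2 * (p : ℝ) + 49 := by positivity
    have : 0 ≤ (3 * (p : ℝ) - 1) * 3 := by linarith
    gcongr
    linarith
  -- `B` is a linear function of `p` that lies in the admissible interval for every `p ≤ 13`
  refine bound_of_eq_one (B := (23 * p + 71) / 200) (by linarith) (by linarith) hg (by positivity)
    (by linarith) hroot ?_ ?_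
  · generalize (3 * (p : ℝ) - 1) * 3 / L = ε at hε
    subst hL
    interval_cases p <;> norm_num at * <;> linarith
  · generalize (3 * (p : ℝ) - 1) * 3 / L = ε at hε
    interval_cases p <;> norm_num at * <;> linarith

/-- The bound on `g` for `t = 1` and `k = p + 1 ≥ 15`; the hypothesis on `m₀` says `2n ≥ 11k`. -/
theorem bound_of_eq_one_of_ge {p m₀ d g L : ℝ} (hp : 14 ≤ p) (hd : 0 ≤ d)
    (hm₀ : 5 / 2 * p + 7 / 2 ≤ m₀) (hdm : p * d + 1 ≤ m₀) (hg : 0 < g)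
    (hL : L = 2 * m₀ + 3 - 2 + g)
    (hroot : (3 * p - 1) * 3 / L + (3 * p - 1) = m₀ * g / (3 + g) + g) :
    (1 + ((p - 1) * d + 6 * (p - 1) + 2 + (3 * p - 1) * 3 / L) / (L - d)) * (3 + g) ≤ p * 3 := by
  have hdm' : d ≤ m₀ := by nlinarith
  have hε : (3 * p - 1) * 3 / L ≤ 9 / 5 := by
    rw [div_le_iff₀ (by linarith)]
    linarith
  refine bound_of_eq_one (B := 17 / 10) (by linarith) (by linarith) hg (by norm_num)
    (by linarith) hroot ?_ ?_
  · generalize (3 * p - 1) * 3 / L = ε at hε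
    subst hL
    have h1 : p * ((p - 1) * d + 6 * (p - 1) + 2 + ε) ≤
        p * (17 / 10 * (2 * m₀ + 3 - 2 + g - d)) := by
      have h2 := mul_le_mul_of_nonneg_right hdm (by linarith : (0 : ℝ) ≤ p + 7 / 10)
      have h3 := mul_le_mul_of_nonneg_right hm₀ (by linarith : (0 : ℝ) ≤ 12 / 5 * p - 7 / 10)
      have h4 := mul_le_mul_of_nonneg_left hε (by linarith : (0 : ℝ) ≤ p)
      have h5 : 0 ≤ p * g := by positivity
      nlinarith
    exact le_of_mul_le_mul_left h1 (by linarith)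
  · generalize (3 * p - 1) * 3 / L = ε at hε
    have h3 := mul_le_mul_of_nonneg_right hm₀ (by linarith : (0 : ℝ) ≤ p - 27 / 10)
    have h4 := mul_le_mul_of_nonneg_left hε (by linarith : (0 : ℝ) ≤ p)
    nlinarith

end ToughKTree

/-! ### Estimates for many non-neighbours -/

namespace ToughKTree

/-- The excess `r = μ - n - 1` of the largest eigenvalue `μ` of the extremal graph for `t = 1` is at
least `c` as soon as `c` is a subsolution of the equation for `r`. Here `p = k - 1`, and `x` is the
size of the clique of the extremal graph. -/
theorem le_of_subsolution {p x r c : ℝ} (hp : 1 ≤ p) (hx : 0 < x) (hr0 : 0 < r)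
    (hA : 0 < 3 * p + 2 - x + r)
    (hr : r = 3 * (x / (3 * p + 2 - x + r)) + 3 * ((3 * p - 1) / (x + 3 * p + r)))
    (hc : c ≤ 3 * (x / (3 * p + 2 - x + c)) + 3 * ((3 * p - 1) / (x + 3 * p + c))) : c ≤ r := by
  by_contra hlt
  rw [not_le] at hlt
  have h1 : x / (3 * p + 2 - x + c) ≤ x / (3 * p + 2 - x + r) := by gcongr
  have h2 : (3 * p - 1) / (x + 3 * p + c) ≤ (3 * p - 1) / (x + 3 * p + r) := by
    have : 0 ≤ 3 * p - 1 := by linarith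
    have : 0 < x + 3 * p + r := by linarith
    gcongr
  linarith

/-- The bound that uses `k = p + 1` non-neighbours for `s = 4`. The clique of the extremal graph has
`x` vertices. Crude bounds suffice for large `r`; for small `r` the summands are compared with those
of `hr`. -/
theorem nonneighbor_bound_four {p : ℕ} {x r : ℝ} (hp : 14 ≤ p) (hx : (p : ℝ) + 24 ≤ x)
    (hx' : x ≤ 5 / 2 * p + 7 / 2) (hr0 : 0 < r) (hA : 0 < 3 * (p : ℝ) + 2 - x + r)
    (hr : r = 3 * (x / (3 * p + 2 - x + r)) + 3 * ((3 * (p : ℝ) - 1) / (x + 3 * p + r))) :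
    (r + 3) / (r + 4 + p) + (3 + (r + 3) / (r + 4 + p)) *
      ((x - p) / (5 * p + 1 - x + r) + (4 * p - 2) / (x + 3 * p + r - 1)) < r := by
  have hp14 : (14 : ℝ) ≤ p := by exact_mod_cast hp
  set ξ := (r + 3) / (r + 4 + p) with hξ
  have hξ0 : 0 < ξ := by positivity
  have hξ1 : ξ < 1 := by rw [hξ, div_lt_one (by positivity)]; linarith
  have hr3 : 3 ≤ r := by
    refine le_of_subsolution (by linarith) (by linarith) hr0 hA hr ?_
    rcases le_or_gt p 17 with hp17 | hp17
    · have hp17' : (p : ℝ) ≤ 17 := by exact_mod_cast hp17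
      have h1 : 1 ≤ x / (3 * p + 2 - x + 3) := by
        rw [le_div_iff₀ (by linarith)]; linarith
      have h2 : 0 ≤ (3 * (p : ℝ) - 1) / (x + 3 * p + 3) := div_nonneg (by linarith) (by linarith)
      linarith
    · have hp17' : (18 : ℝ) ≤ p := by exact_mod_cast hp17
      have h1 : 1 / 2 ≤ x / (3 * p + 2 - x + 3) := by
        rw [le_div_iff₀ (by linarith)]; linarith
      have h2 : 1 / 2 ≤ (3 * (p : ℝ) - 1) / (x + 3 * p + 3) := by
        rw [le_div_iff₀ (by linarith)]; linarith
      linarith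
  have hU : (x - p) / (5 * p + 1 - x + r) + (4 * p - 2) / (x + 3 * p + r - 1) ≤ 7 / 5 := by
    have h1 : (x - p) / (5 * p + 1 - x + r) ≤ (x - p) / (5 * p + 4 - x) := by
      have : 0 ≤ x - p := by linarith
      have : 0 < 5 * p + 4 - x := by linarith
      gcongr
      linarith
    have h2 : (4 * (p : ℝ) - 2) / (x + 3 * p + r - 1) ≤ (4 * p - 2) / (x + 3 * p + 2) := by
      have : 0 ≤ 4 * (p : ℝ) - 2 := by linarith
      have : 0 < x + 3 * p + 2 := by linarith
      gcongr
      linarith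
    have h3 : (x - p) / (5 * p + 4 - x) + (4 * p - 2) / (x + 3 * p + 2) ≤ 7 / 5 := by
      have e1 : 0 < 5 * p + 4 - x := by linarith
      have e2 : 0 < x + 3 * p + 2 := by linarith
      rw [div_add_div _ _ e1.ne' e2.ne', div_le_iff₀ (by positivity)]
      nlinarith [mul_nonneg (sub_nonneg.2 hx) (sub_nonneg.2 hx'),
        mul_nonneg (sub_nonneg.2 hx) (sub_nonneg.2 hp14),
        mul_nonneg (sub_nonneg.2 hx') (sub_nonneg.2 hp14)]
    linarith
  have hU0 : 0 ≤ (x - p) / (5 * p + 1 - x + r) + (4 * p - 2) / (x + 3 * p + r - 1) := by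
    refine add_nonneg (div_nonneg ?_ ?_) (div_nonneg ?_ ?_) <;> linarith
  rcases le_or_gt (33 / 5) r with h66 | h66
  · nlinarith
  have hp21 : 21 ≤ p := by
    by_contra hlt
    have hp20 : p ≤ 20 := by omega
    have hp20' : (p : ℝ) ≤ 20 := by exact_mod_cast hp20
    refine absurd (le_of_subsolution (c := 33 / 5) (by linarith) (by linarith) hr0 hA hr ?_)
      (not_le.2 h66)
    have h1 : 44 / 25 ≤ x / (3 * p + 2 - x + 33 / 5) := by
      rw [le_div_iff₀ (by linarith)]; linarith
    have h2 : 22 / 50 ≤ (3 * (p : ℝ) - 1) / (x + 3 * p + 33 / 5) := by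
      rw [le_div_iff₀ (by linarith)]; linarith
    linarith
  have hp21' : (21 : ℝ) ≤ p := by exact_mod_cast hp21
  have hξ2 : ξ ≤ 31 / 100 := by
    rw [hξ, div_le_iff₀ (by positivity)]
    linarith
  have hY : (x - p) / (5 * p + 1 - x + r) + 1 / 2 ≤ x / (3 * p + 2 - x + r) := by
    obtain ⟨A, hAdef⟩ : ∃ A, A = 3 * (p : ℝ) + 2 - x + r := ⟨_, rfl⟩
    rw [show 5 * (p : ℝ) + 1 - x + r = A + 2 * p - 1 by rw [hAdef]; ring, ← hAdef]
    rw [← hAdef] at hA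
    have hA2 : 0 < A + 2 * p - 1 := by linarith
    rw [div_add_div _ _ hA2.ne' (by norm_num), div_le_div_iff₀ (by positivity) hA]
    have hA3 : A ≤ 2 * p - 15 := by linarith
    have hx0 : A ≤ 2 * x := by linarith
    nlinarith [mul_nonneg hA.le (sub_nonneg.2 hA3),
      mul_nonneg (sub_nonneg.2 hx0) (by linarith : (0 : ℝ) ≤ 2 * p - 1)]
  have hZ : (4 * (p : ℝ) - 2) / (x + 3 * p + r - 1) ≤ (3 * p - 1) / (x + 3 * p + r) + 1 / 4 := by
    obtain ⟨L, hL⟩ : ∃ L, L = x + 3 * (p : ℝ) + r := ⟨_, rfl⟩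
    rw [← hL]
    have hL1 : 4 * (p : ℝ) + 24 ≤ L := by linarith
    have hL0 : 0 < L := by linarith
    rw [div_add_div _ _ hL0.ne' (by norm_num), div_le_div_iff₀ (by linarith) (by positivity)]
    nlinarith [mul_nonneg hL0.le (sub_nonneg.2 hL1)]
  nlinarith

/-- The bound that uses `k = p + 1` non-neighbours for `s = 5`, with `x` the size of the clique of
the extremal graph. -/
theorem nonneighbor_bound_five {p : ℕ} {x r : ℝ} (hp : 14 ≤ p) (hx : (p : ℝ) + 24 ≤ x)
    (hx2 : 2 * (p : ℝ) + 1 ≤ x) (hx' : x ≤ 5 / 2 * p + 7 / 2) (hr0 : 0 < r)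
    (hA : 0 < 3 * (p : ℝ) + 2 - x + r)
    (hr : r = 3 * (x / (3 * p + 2 - x + r)) + 3 * ((3 * (p : ℝ) - 1) / (x + 3 * p + r))) :
    1 + (r + 3) / (r + 4 + p) + (4 + (r + 3) / (r + 4 + p)) *
      ((x - 2 * p) / (7 * p - x + r) + (5 * p - 3) / (x + 3 * p + r - 2)) < r := by
  have hp14 : (14 : ℝ) ≤ p := by exact_mod_cast hp
  set ξ := (r + 3) / (r + 4 + p) with hξ
  have hξ0 : 0 < ξ := by positivity
  have hξ1 : ξ < 1 := by rw [hξ, div_lt_one (by positivity)]; linarith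
  have hr6 : 6 ≤ r := by
    refine le_of_subsolution (by linarith) (by linarith) hr0 hA hr ?_
    have h1 : 23 / 15 ≤ x / (3 * p + 2 - x + 6) := by
      rw [le_div_iff₀ (by linarith)]; linarith
    have h2 : 7 / 15 ≤ (3 * (p : ℝ) - 1) / (x + 3 * p + 6) := by
      rw [le_div_iff₀ (by linarith)]; linarith
    linarith
  have hU : (x - 2 * p) / (7 * p - x + r) + (5 * p - 3) / (x + 3 * p + r - 2) ≤ 103 / 100 := by
    have h1 : (x - 2 * p) / (7 * p - x + r) ≤ (x - 2 * p) / (7 * p + 6 - x) := by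
      have : 0 ≤ x - 2 * p := by linarith
      have : 0 < 7 * p + 6 - x := by linarith
      gcongr
      linarith
    have h2 : (5 * (p : ℝ) - 3) / (x + 3 * p + r - 2) ≤ (5 * p - 3) / (x + 3 * p + 4) := by
      have : 0 ≤ 5 * (p : ℝ) - 3 := by linarith
      have : 0 < x + 3 * p + 4 := by linarith
      gcongr
      linarith
    have h3 : (x - 2 * p) / (7 * p + 6 - x) + (5 * p - 3) / (x + 3 * p + 4) ≤ 103 / 100 := by
      have e1 : 0 < 7 * p + 6 - x := by linarith
      have e2 : 0 < x + 3 * p + 4 := by linarith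
      rw [div_add_div _ _ e1.ne' e2.ne', div_le_iff₀ (by positivity)]
      nlinarith [mul_nonneg (sub_nonneg.2 hx2) (sub_nonneg.2 hx'),
        mul_nonneg (sub_nonneg.2 hx2) (sub_nonneg.2 hp14),
        mul_nonneg (sub_nonneg.2 hx') (sub_nonneg.2 hp14)]
    linarith
  have hU0 : 0 ≤ (x - 2 * p) / (7 * p - x + r) + (5 * p - 3) / (x + 3 * p + r - 2) := by
    refine add_nonneg (div_nonneg ?_ ?_) (div_nonneg ?_ ?_) <;> linarith
  rcases le_or_gt (36 / 5) r with h72 | h72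
  · nlinarith
  have hξ2 : ξ ≤ 41 / 100 := by
    rw [hξ, div_le_iff₀ (by positivity)]
    linarith
  nlinarith

end ToughKTree

/-! ### Comparison with the extremal graph -/

namespace SimpleGraph

open Classical in
/-- The supersolution for as many non-neighbours as `p + 1`, with the eigenvalue written as
`n + 1 + r` and the weight `ξ = (r + 3) / (r + 4 + p)` at the vertex `u`. -/
theorem signlessRadius_lt_of_nonneighbors {V : Type*} [Fintype V] (G : SimpleGraph V)
    {S : Finset V} {u : V} (hu : u ∈ S) {m a p : ℕ} {μ r : ℝ} (hm : 1 ≤ m)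
    (hcard : Fintype.card V = #S + m + a)
    (hc : a + 1 ≤ ToughKTree.numComponents (ToughKTree.deleteVertices G S))
    (hM : p + 1 ≤ #{v | v ∉ S ∧ ¬ G.Adj u v}) (hr : 0 < r) (hμr : μ = #S + m + a + 1 + r)
    (hμ : 0 < μ - #S - 2 * m + 2)
    (h : (#S : ℝ) - 4 + ((r + 3) / (r + 4 + p) + (#S - 1 + (r + 3) / (r + 4 + p)) *
      (m / (μ - #S - 2 * m + 2) + a / (μ - #S))) < r) :
    ToughKTree.signlessRadius G < μ := by
  have hm' : (1 : ℝ) ≤ m := by exact_mod_cast hm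
  have hs1 : (1 : ℝ) ≤ #S := by exact_mod_cast Finset.card_pos.2 ⟨u, hu⟩
  have hμs : 0 < μ - #S := by linarith
  set ξ := (r + 3) / (r + 4 + p) with hξ
  have hξ0 : 0 < ξ := by positivity
  have hξr : ξ * (r + 4 + p) = r + 3 := div_mul_cancel₀ _ (by positivity)
  set U := m / (μ - #S - 2 * m + 2) + a / (μ - #S) with hU
  have hU0 : 0 < U := by positivity
  -- any `σ > #S - 1 + ξ` close enough to that number will do
  obtain ⟨σ, hσ, hσ'⟩ : ∃ σ, #S - 1 + ξ < σ ∧ (#S : ℝ) - 4 + (ξ + σ * U) < r := by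
    refine ⟨#S - 1 + ξ + (r - (#S - 4 + (ξ + (#S - 1 + ξ) * U))) / (2 * U), ?_, ?_⟩
    · have := sub_pos.2 h
      have : 0 < (r - (#S - 4 + (ξ + (#S - 1 + ξ) * U))) / (2 * U) := by positivity
      linarith
    · have : (r - (#S - 4 + (ξ + (#S - 1 + ξ) * U))) / (2 * U) * U =
          (r - (#S - 4 + (ξ + (#S - 1 + ξ) * U))) / 2 := by
        field_simp
      rw [add_mul _ _ U, this]
      linarith
  have hT : m * (σ / (μ - #S - 2 * m + 2)) + a * (σ / (μ - #S)) = σ * U := by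
    rw [hU]
    ring
  refine G.signlessRadius_lt_of_components hu (ξ := ξ) (σ := σ) hm hcard hc hM hξ0 hσ hμ ?_ ?_
  · rw [hT]
    linarith
  · rw [hT]
    push_cast
    rw [hμr]
    linarith

end SimpleGraph

namespace ToughKTree

/-- The parameters of the extremal graph `H` for `k = e + 2`: the clique `K_{n-3t(k-1)-2}` has `m₀`
vertices, and `g` solves the equation of the largest eigenvalue. -/
theorem exists_root_extremalGraph {n e t : ℕ} (ht : 1 ≤ t) (hn : 3 * t * (e + 1) + 3 ≤ n) :
    ∃ m₀ : ℕ, ∃ g : ℝ, 1 ≤ m₀ ∧ m₀ + 3 * t * (e + 1) + 2 = n ∧ 0 < g ∧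
      (e * (3 * t) + 2) * (3 * t) / (2 * (m₀ : ℝ) + 3 * t - 2 + g) + (e * (3 * (t : ℝ)) + 2) =
        m₀ * g / (3 * t + g) + g ∧
      2 * (m₀ : ℝ) + 2 * (3 * t) - 2 + g ≤ signlessRadius (extremalGraph n (e + 2) t) := by
  have ht' : (1 : ℝ) ≤ t := by exact_mod_cast ht
  obtain ⟨m₀, hm₀⟩ : ∃ m₀, m₀ = n - 3 * t * (e + 2 - 1) - 2 := ⟨_, rfl⟩
  have hm₀' : m₀ + 3 * t * (e + 1) + 2 = n := by
    rw [hm₀, show e + 2 - 1 = e + 1 by omega]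
    omega
  have hm1 : 1 ≤ m₀ := by omega
  have hm1' : (1 : ℝ) ≤ m₀ := by exact_mod_cast hm1
  obtain ⟨g, hg, hroot⟩ := SimpleGraph.exists_root (s := 3 * t) (m := m₀)
    (a := e * (3 * t) + 2) (by positivity) hm1' (by positivity)
  refine ⟨m₀, g, hm1, hm₀', hg, hroot, ?_⟩
  have := SimpleGraph.le_signlessRadius_join_of_root (s := 3 * t) (m := m₀)
    (a := 3 * t * (e + 2 - 2) + 2) (g := g) (by omega) hm1 hg (by
      rw [Nat.add_sub_cancel]
      push_cast
      rw [mul_comm (3 * (t : ℝ)) e]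
      exact hroot)
  rw [extremalGraph, ← hm₀]
  push_cast at this
  exact this

open Classical in
/-- One non-neighbour suffices unless `t = 1`, `15 ≤ k` and `2n < 11k`. -/
theorem signlessRadius_lt_of_large {V : Type*} [Fintype V] (G : SimpleGraph V) {e t : ℕ}
    {S : Finset V} {u : V} (he : 1 ≤ e) (ht : 1 ≤ t)
    (hsize : 3 * (e + 2) * t ^ 2 + (e + 2) + 18 * t + 4 ≤ Fintype.card V)
    (hlarge : ¬ (t = 1 ∧ 13 ≤ e ∧ 2 * Fintype.card V < 11 * (e + 2))) (hu : u ∈ S)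
    (hS : 3 * t ≤ #S) (hc : e * #S + 3 ≤ numComponents (deleteVertices G S))
    (hM : 1 ≤ #{v | v ∉ S ∧ ¬ G.Adj u v}) :
    signlessRadius G < signlessRadius (extremalGraph (Fintype.card V) (e + 2) t) := by
  have hsizeR : 3 * ((e : ℝ) + 2) * t ^ 2 + (e + 2) + 18 * t + 4 ≤ (Fintype.card V : ℝ) := by
    exact_mod_cast hsize
  obtain ⟨m₀, g, hm1, hm₀, hg, hroot, hle⟩ := exists_root_extremalGraph (n := Fintype.card V)
    (e := e) ht (by nlinarith)
  refine lt_of_lt_of_le ?_ hle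
  obtain ⟨d, hd⟩ := Nat.exists_eq_add_of_le hS
  have hcS := G.numComponents_deleteVertices_add_card_le S
  obtain ⟨m, hm⟩ := Nat.exists_eq_add_of_le
    (show #S + (e * #S + 2) + 1 ≤ Fintype.card V by omega)
  have hdR : (#S : ℝ) = 3 * t + d := by exact_mod_cast hd
  have hmR : (Fintype.card V : ℝ) = #S + (e * #S + 2) + 1 + m := by exact_mod_cast hm
  have hm₀R : (m₀ : ℝ) + 3 * t * (e + 1) + 2 = (Fintype.card V : ℝ) := by exact_mod_cast hm₀
  have hmm : (m₀ : ℝ) = (m + 1 : ℕ) + (e + 1) * d := by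
    push_cast
    rw [← hm₀R, hdR] at hmR
    linarith
  have htR : (1 : ℝ) ≤ t := by exact_mod_cast ht
  have heR : (1 : ℝ) ≤ e := by exact_mod_cast he
  have hm1R : (1 : ℝ) ≤ m₀ := by exact_mod_cast hm1
  have hd0 : (0 : ℝ) ≤ d := by positivity
  have hm0 : (0 : ℝ) ≤ m := by positivity
  obtain ⟨L, hL⟩ : ∃ L, L = 2 * (m₀ : ℝ) + 3 * t - 2 + g := ⟨_, rfl⟩
  have hdm : ((e : ℝ) + 1) * d + 1 ≤ m₀ := by rw [hmm]; push_cast; linarith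
  have hLd : 0 < L - d := by
    have : 0 ≤ e * (d : ℝ) := by positivity
    linarith
  rw [← hL] at hroot
  have hX : (1 + (((e : ℝ) + 1 - 1) * d + 2 * (e + 1 - 1) * (3 * t) + 2 +
      (e * (3 * t) + 2) * (3 * t) / L) / (L - d)) * (3 * t + g) ≤ (e + 1) * (3 * t) := by
    rcases Nat.lt_or_ge t 2 with ht2 | ht2
    · obtain rfl : t = 1 := by omega
      norm_num at hroot hsizeR hL hm₀R ⊢
      rw [show (e : ℝ) * 3 + 2 = 3 * ((e : ℝ) + 1) - 1 by ring] at hroot ⊢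
      rcases Nat.lt_or_ge e 13 with he13 | he13
      · have := bound_of_eq_one_of_le (p := e + 1) (m₀ := m₀) (d := d) (g := g) (L := L)
          (by omega) (by omega) hd0 (by push_cast; linarith) (by push_cast; linarith) hg
          (by linarith) (by push_cast; exact hroot)
        push_cast at this
        convert this using 4
        ring
      · have hlarge' : 11 * ((e : ℝ) + 2) ≤ 2 * Fintype.card V := by
          have : 11 * (e + 2) ≤ 2 * Fintype.card V := by
            by_contra h
            exact hlarge ⟨rfl, he13, by omega⟩
          exact_mod_cast this
        have he13' : (13 : ℝ) ≤ e := by exact_mod_cast he13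
        have := bound_of_eq_one_of_ge (p := e + 1) (m₀ := m₀) (d := d) (g := g) (L := L)
          (by linarith) hd0 (by linarith) (by linarith) hg (by linarith) hroot
        convert this using 4
        ring
    · have ht2R : (2 : ℝ) ≤ t := by exact_mod_cast ht2
      refine bound_of_two_le (t := t) (m₀ := m₀) (by linarith) ht2R rfl hd0 (by linarith) hg
        (by ring) ?_ hL hroot
      linarith
  have key := supersolution_of_bound (p := e + 1) (s₀ := 3 * t) (m := (m + 1 : ℕ)) (m₀ := m₀)
    (d := d) (L := L) (a₀ := e * (3 * t) + 2) (by linarith) (by simp) hd0 (by linarith) hg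
    (by ring) hmm hLd hroot hX
  have e1 : 2 * (m₀ : ℝ) + 2 * (3 * t) - 2 + g - #S - 2 * (m + 1 : ℕ) + 2 =
      3 * t + d + 2 * (e + 1 - 1) * d + g := by
    rw [hmm, hdR]; ring
  have e2 : 2 * (m₀ : ℝ) + 2 * (3 * t) - 2 + g - #S = L - d := by
    rw [hL, hdR]; ring
  refine G.signlessRadius_lt_of_nonneighbor hu (m := m + 1) (a := e * #S + 2) (by omega) (by omega)
    (by omega) hM ?_ ?_
  · rw [e1]
    have : 0 ≤ e * (d : ℝ) := by positivity
    linarith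
  · rw [e1, e2, hdR]
    rw [show ((e * #S + 2 : ℕ) : ℝ) = e * (3 * t) + 2 + (e + 1 - 1) * d by
      push_cast; rw [hdR]; ring]
    rw [hmm]
    linarith

open Classical in
/-- For `t = 1`, `15 ≤ k` and `2n < 11k` there are `k` non-neighbours, and then it suffices to treat
`3 ≤ #S ≤ 5`. -/
theorem signlessRadius_lt_of_small {V : Type*} [Fintype V] (G : SimpleGraph V) {e : ℕ}
    {S : Finset V} {u : V} (he : 13 ≤ e) (hsize : 4 * (e + 2) + 22 ≤ Fintype.card V)
    (hsmall : 2 * Fintype.card V < 11 * (e + 2)) (hu : u ∈ S)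
    (hS : 3 ≤ #S) (hc : e * #S + 3 ≤ numComponents (deleteVertices G S))
    (hM : e + 2 ≤ #{v | v ∉ S ∧ ¬ G.Adj u v}) :
    signlessRadius G < signlessRadius (extremalGraph (Fintype.card V) (e + 2) 1) := by
  have hsizeR : 4 * ((e : ℝ) + 2) + 22 ≤ (Fintype.card V : ℝ) := by exact_mod_cast hsize
  have hsmallR : 2 * (Fintype.card V : ℝ) < 11 * ((e : ℝ) + 2) := by exact_mod_cast hsmall
  have heR : (13 : ℝ) ≤ e := by exact_mod_cast he
  obtain ⟨m₀, g, hm1, hm₀, hg, hroot, hle⟩ := exists_root_extremalGraph (n := Fintype.card V)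
    (e := e) le_rfl (by omega)
  refine lt_of_lt_of_le ?_ hle
  have hcS := G.numComponents_deleteVertices_add_card_le S
  have hS5 : #S ≤ 5 := by
    by_contra h
    have : e * 6 ≤ e * #S := Nat.mul_le_mul_left _ (by omega)
    omega
  obtain ⟨m, hm⟩ := Nat.exists_eq_add_of_le
    (show #S + (e * #S + 2) + 1 ≤ Fintype.card V by omega)
  have hmR : (Fintype.card V : ℝ) = #S + (e * #S + 2) + 1 + m := by exact_mod_cast hm
  have hm₀R : (m₀ : ℝ) + 3 * (e + 1) + 2 = (Fintype.card V : ℝ) := by exact_mod_cast hm₀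
  have hm0 : (0 : ℝ) ≤ m := by positivity
  norm_num at hroot ⊢
  -- `r = μ - n - 1` replaces `g`
  obtain ⟨r, hr⟩ : ∃ r, r = m₀ - (3 * (e : ℝ) + 2) + g := ⟨_, rfl⟩
  obtain rfl : g = r - m₀ + (3 * e + 2) := by linarith
  have hA : 0 < 3 + (r - m₀ + (3 * e + 2)) := by linarith
  have hr0 : 0 < r := by
    have h1 : m₀ * (r - m₀ + (3 * e + 2)) / (3 + (r - m₀ + (3 * e + 2))) <  m₀ := by
      rw [div_lt_iff₀ hA]
      have : 0 < (m₀ : ℝ) := by exact_mod_cast hm1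
      nlinarith
    have h2 : 0 ≤ (e * 3 + 2) * 3 / (2 * (m₀ : ℝ) + 3 - 2 + (r - m₀ + (3 * e + 2))) :=
      div_nonneg (by positivity) (by linarith)
    linarith
  have hrr : r = 3 * ((m₀ : ℝ) / (3 * (e + 1 : ℕ) + 2 - m₀ + r)) +
      3 * ((3 * ((e + 1 : ℕ) : ℝ) - 1) / (m₀ + 3 * (e + 1 : ℕ) + r)) := by
    push_cast
    rw [show 3 * ((e : ℝ) + 1) + 2 - m₀ + r = 3 + (r - m₀ + (3 * e + 2)) by ring,
      show (m₀ : ℝ) + 3 * (e + 1) + r = 2 * m₀ + 3 - 2 + (r - m₀ + (3 * e + 2)) by ring]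
    have e1 : m₀ * (r - m₀ + (3 * e + 2)) / (3 + (r - m₀ + (3 * e + 2))) =
        m₀ - 3 * (m₀ / (3 + (r - m₀ + (3 * e + 2)))) := by
      field_simp
      ring
    rw [e1] at hroot
    rw [show (3 * ((e : ℝ) + 1) - 1) = e * 3 + 2 by ring]
    rw [mul_div_right_comm, mul_comm (_ / _)] at hroot
    linarith
  have hx1 : ((e + 1 : ℕ) : ℝ) + 24 ≤ m₀ := by push_cast; linarith
  have hx2 : (m₀ : ℝ) ≤ 5 / 2 * (e + 1 : ℕ) + 7 / 2 := by push_cast; linarith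
  have hA' : 0 < 3 * ((e + 1 : ℕ) : ℝ) + 2 - m₀ + r := by push_cast; linarith
  obtain hS3 | hS3 | hS3 : #S = 3 ∨ #S = 4 ∨ #S = 5 := by omega
  · have hmm : (m₀ : ℝ) = (m + 1 : ℕ) := by
      push_cast
      rw [hS3] at hmR
      push_cast at hmR
      linarith
    refine G.signlessRadius_lt_of_nonneighbor hu (m := m + 1) (a := e * #S + 2) (by omega)
      (by omega) (by omega) (by omega) ?_ ?_
    · rw [← hmm, hS3]
      push_cast
      linarith
    · rw [hS3, ← hmm]
      push_cast at hrr ⊢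
      rw [show 2 * (m₀ : ℝ) + 6 - 2 + (r - m₀ + (3 * e + 2)) - 3 - 2 * m₀ + 2 =
          3 * (e + 1) + 2 - m₀ + r by ring,
        show 2 * (m₀ : ℝ) + 6 - 2 + (r - m₀ + (3 * e + 2)) - 3 = m₀ + 3 * (e + 1) + r by ring]
      rw [mul_div_left_comm, mul_div_left_comm (_ + _), show (e : ℝ) * 3 + 2 = 3 * (e + 1) - 1 by
        ring]
      linarith
  · have hmm : (m₀ : ℝ) = (m + 1 : ℕ) + (e + 1) := by
      push_cast
      rw [hS3] at hmR
      push_cast at hmR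
      linarith
    refine G.signlessRadius_lt_of_nonneighbors hu (m := m + 1) (a := e * #S + 2) (p := e + 1)
      (r := r) (by omega) (by omega) (by omega) hM hr0 ?_ ?_ ?_
    · rw [hS3, hmm]
      push_cast
      ring
    · rw [hS3]
      push_cast at hmm hx1 ⊢
      linarith
    · have := nonneighbor_bound_four (p := e + 1) (by omega) hx1 hx2 hr0 hA' hrr
      rw [hS3]
      convert this using 1
      rw [hmm]
      push_cast
      ring_nf
  · have hmm : (m₀ : ℝ) = (m + 1 : ℕ) + 2 * (e + 1) := by
      push_cast
      rw [hS3] at hmR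
      push_cast at hmR
      linarith
    refine G.signlessRadius_lt_of_nonneighbors hu (m := m + 1) (a := e * #S + 2) (p := e + 1)
      (r := r) (by omega) (by omega) (by omega) hM hr0 ?_ ?_ ?_
    · rw [hS3, hmm]
      push_cast
      ring
    · rw [hS3]
      push_cast at hmm hx1 ⊢
      linarith
    · have := nonneighbor_bound_five (p := e + 1) (by omega) hx1
        (by rw [hmm]; push_cast; linarith) hx2 hr0 hA' hrr
      rw [hS3]
      convert this using 1
      rw [hmm]
      push_cast
      ring_nf

end ToughKTree

theorem theorem1p3 {V : Type*} [Fintype V] (G : SimpleGraph V) (n k t : ℕ)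
    (hn : Fintype.card V = n) (hk : 3 ≤ k) (ht : 1 ≤ t)
    (hconn : G.Connected)
    (htough : ToughKTree.IsTough G ((t : ℝ) / ((t : ℝ) * ((k : ℝ) - 2) + 1)))
    (hsize : 3 * k * t ^ 2 + k + 18 * t + 4 ≤ n)
    (hq : ToughKTree.signlessRadius (ToughKTree.extremalGraph n k t) ≤
      ToughKTree.signlessRadius G) :
    ToughKTree.HasSpanningKTree G k ∨ Nonempty (G ≃g ToughKTree.extremalGraph n k t) := by
  classical
  left
  by_contra htree
  subst hn
  obtain ⟨e, rfl⟩ := Nat.exists_eq_add_of_le' (show 2 ≤ k by omega)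
  refine hq.not_gt ?_
  by_cases hB : t = 1 ∧ 13 ≤ e ∧ 2 * Fintype.card V < 11 * (e + 2)
  · obtain ⟨rfl, he, hsmall⟩ := hB
    obtain ⟨S, hc, hS, u, hu, hM⟩ := SimpleGraph.exists_finset_with_nonneighbors (N := e + 1)
      hk ht hconn htough (by omega) (by nlinarith) htree
    refine ToughKTree.signlessRadius_lt_of_small G he (by omega) hsmall hu (by omega) ?_ ?_
    · rw [add_mul] at hc
      omega
    · convert hM
  · obtain ⟨S, hc, hS, u, hu, hM⟩ := SimpleGraph.exists_finset_with_nonneighbors (N := 0)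
      hk ht hconn htough (by omega) (by nlinarith) htree
    refine ToughKTree.signlessRadius_lt_of_large G (by omega) ht hsize hB hu hS ?_ ?_
    · rw [add_mul] at hc
      omega
    · convert hM
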